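/- Let $(X,\mathcal O_X)$ be a locally ringed space over $\mathbb C$ and let $\mathfrak X=(X,\mathcal O_{\mathfrak X})$ be a supermanifold over it of odd dimension $q$. That is, $\mathcal O_{\mathfrak X}=\mathcal O_{\mathfrak X,+}\oplus\mathcal O_{\mathfrak X,-}$ is a sheaf of supercommutative $\mathbb C$-algebras with an augmentation $\alpha:\mathcal O_{\mathfrak X}\twoheadrightarrow\mathcal O_X$, and it is locally isomorphic, as a sheaf of augmented superalgebras, to $\wedge^\bullet_{\mathcal O_X}\mathcal E$ with $\mathcal E$ a locally free $\mathcal O_X$-module of rank $q$. Put $\mathcal J=\ker\alpha$ and $T^*_{X,-}=\mathcal J/\mathcal J^2$, and let $\widehat{\mathfrak X}=(X,\wedge^\bullet_{\mathcal O_X}T^*_{X,-})$ be the split model of $\mathfrak X$. Its Euler vector field $\epsilon$ is the $\mathcal O_X$-linear derivation of $\wedge^\bullet_{\mathcal O_X} T^*_{X,-}$ that extends the identity of $T^*_{X,-}$. A global vector field on $\mathfrak X$ is a global section $H=H_++H_-$ of the sheaf $T_{\mathfrak X}=T_{\mathfrak X,+}\oplus T_{\mathfrak X,-}$ of $\mathbb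 C$-linear superderivations of $\mathcal O_{\mathfrak X}$. Put $T^{(m)}_{\mathfrak X}=\{\nu\in T_{\mathfrak X}:\nu(\mathcal J^\ell)\subset\mathcal J^{\ell+m}\text{ for all }\ell\ge0\}$. We say that $H$ has initial form $\epsilon$ if $H\in H^0(X,T^{(0)}_{\mathfrak X})$ and the class of $H$ in $T^{(0)}_{\mathfrak X}/T^{(1)}_{\mathfrak X}$, the sheaf of degree-zero vector fields on $\widehat{\mathfrak X}$, is $\epsilon$; equivalently, $H$ acts on $\bigoplus_m\mathcal J^m/\mathcal J^{m+1}\cong\wedge^\bullet_{\mathcal O_X} T^*_{X,-}$ as $\epsilon$. **Theorem.** Let $H$ be a global vector field on $\mathfrak X$ with initial form $\epsilon$. For $D=H$ or $D=H_+$ define $\mathbb C$-linear operators on $\mathcal O_{\mathfrak X}$ by $$O^{(1)}_D=\frac1{q!}\prod_{j=1}^q(j-D),\qquad O^{(2)}_D=\frac1{(q-1)!}\prod_{j=2}^q(j-D)$$ (for $q=0$ both are the identity). Then: 1. $O^{(1)}_H$ has kernel $\mathcal J$ and satisfies $O^{(1)}_H(f)\equiv f \bmod \mathcal J$, so it splits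 $0\to\mathcal J\to\mathcal O_{\mathfrak X}\to\mathcal O_X\to0$ as a sequence of sheaves of $\mathbb C$-vector spaces. 2. $O^{(2)}_H$ maps $\mathcal J$ to $\mathcal J$, its restriction to $\mathcal J$ has kernel $\mathcal J^2$, and $O^{(2)}_H(f)\equiv f \bmod \mathcal J^2$ for $f\in\mathcal J$, so it splits $0\to\mathcal J^2\to\mathcal J\to T^*_{X,-}\to0$ as a sequence of sheaves of $\mathbb C$-vector spaces. 3. $H$ defines a splitting of $\mathfrak X$: there is exactly one even isomorphism of superspaces $\Phi:\mathcal O_{\mathfrak X}\to\wedge^\bullet_{\mathcal O_X}T^*_{X,-}$ over the identity of $(X,\mathcal O_X)$ (an isomorphism of sheaves of $\mathbb C$-superalgebras compatible with the augmentations) such that, for all local sections, $$\Phi\big(O^{(1)}_{H_+}(f)\big)=\alpha(f)\quad(f\in\mathcal O_{\mathfrak X}),\qquad \Phi\big(O^{(2)}_{H_+}(f)\big)=f \bmod \mathcal J^2\in T^*_{X,-}\quad(f\in\mathcal J).$$ (If $H$ is even, then $H_+=H$.) -/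

import Mathlib

open CategoryTheory TopologicalSpace Opposite

universe u

noncomputable section

/-! ### Exterior algebras -/

section Exterior

variable {R M : Type*} [CommRing R] [AddCommGroup M] [Module R M]

lemma zmod2 : ∀ i : ZMod 2, i = 0 ∨ i = 1 := by decide

lemma ext_supercomm (i j : ZMod 2) (a b : ExteriorAlgebra R M)
    (ha : a ∈ CliffordAlgebra.evenOdd (0 : QuadraticForm R M) i)
    (hb : b ∈ CliffordAlgebra.evenOdd (0 : QuadraticForm R M) j) :
    a * b = (-1) ^ (i.val * j.val) * (b * a) := by
  have h := CliffordAlgebra.map_mul_map_of_isOrtho_of_mem_evenOdd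
    (QuadraticMap.Isometry.id (0 : QuadraticForm R M)) (QuadraticMap.Isometry.id _)
    (fun x y => QuadraticMap.IsOrtho.all x y) a b ha hb
  simp only [CliffordAlgebra.map_id, AlgHom.coe_id, id_eq] at h
  rw [h]
  obtain rfl | rfl := zmod2 i <;> obtain rfl | rfl := zmod2 j <;> simp [ZMod.val_one]

/-- The algebra homomorphism from `⋀ M` to the dual numbers over `⋀ M` with `m ↦ m + φ(m) ε`. -/
def extLift (φ : M →ₗ[R] M) : ExteriorAlgebra R M →ₐ[R] DualNumber (ExteriorAlgebra R M) :=
  ExteriorAlgebra.lift R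
    ⟨{ toFun := fun m => TrivSqZeroExt.inl (ExteriorAlgebra.ι R m) +
          TrivSqZeroExt.inr (ExteriorAlgebra.ι R (φ m))
       map_add' := fun a b => by ext <;> simp
       map_smul' := fun a b => by ext <;> simp },
      fun m => by ext <;> simp [ExteriorAlgebra.ι_add_mul_swap]⟩

/-- The `R`-linear derivation of `⋀ M` which extends the endomorphism `φ` of `M`: the coefficient
of `ε` in the homomorphism above. -/
def extDer (φ : M →ₗ[R] M) : ExteriorAlgebra R M →ₗ[R] ExteriorAlgebra R M where
  toFun a := (extLift φ a).snd
  map_add' a b := by simp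
  map_smul' r a := by simp

lemma extDer_ι (φ : M →ₗ[R] M) (m : M) :
    extDer φ (ExteriorAlgebra.ι R m) = ExteriorAlgebra.ι R (φ m) := by
  simp [extDer, extLift]

lemma extDer_algebraMap (φ : M →ₗ[R] M) (r : R) : extDer φ (algebraMap R _ r) = 0 := by
  simp [extDer, TrivSqZeroExt.algebraMap_eq_inl']

lemma extDer_mul (φ : M →ₗ[R] M) (a b : ExteriorAlgebra R M) :
    extDer φ (a * b) = extDer φ a * b + a * extDer φ b := by
  have key : (TrivSqZeroExt.fstHom R (ExteriorAlgebra R M) (ExteriorAlgebra R M)).comp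
      (extLift φ) = AlgHom.id R _ := by
    ext m
    simp [extLift]
  have ha := AlgHom.congr_fun key a
  have hb := AlgHom.congr_fun key b
  simp only [AlgHom.comp_apply, AlgHom.id_apply, TrivSqZeroExt.fstHom_apply] at ha hb
  simp [extDer, TrivSqZeroExt.snd_mul, ha, hb, add_comm]

lemma extDer_parity (φ : M →ₗ[R] M) (i : ZMod 2) (a : ExteriorAlgebra R M)
    (ha : a ∈ CliffordAlgebra.evenOdd (0 : QuadraticForm R M) i) :
    extDer φ a ∈ CliffordAlgebra.evenOdd (0 : QuadraticForm R M) i := by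
  have hι : ∀ m₁ m₂ : M, ∀ x ∈ CliffordAlgebra.evenOdd (0 : QuadraticForm R M) i,
      ExteriorAlgebra.ι R m₁ * ExteriorAlgebra.ι R m₂ * x ∈
        CliffordAlgebra.evenOdd (0 : QuadraticForm R M) i := by
    intro m₁ m₂ x hx
    have := SetLike.mul_mem_graded (A := CliffordAlgebra.evenOdd (0 : QuadraticForm R M))
      (CliffordAlgebra.ι_mul_ι_mem_evenOdd_zero (0 : QuadraticForm R M) m₁ m₂) hx
    rwa [zero_add] at this
  induction a, ha using CliffordAlgebra.evenOdd_induction with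
  | range_ι_pow v h =>
    obtain rfl | rfl := zmod2 i
    · obtain ⟨r, rfl⟩ := Submodule.mem_one.mp h
      erw [extDer_algebraMap]; exact zero_mem _
    · have h' : v ∈ LinearMap.range (CliffordAlgebra.ι (0 : QuadraticForm R M)) := by
        simpa [ZMod.val_one] using h
      obtain ⟨m, rfl⟩ := h'
      erw [extDer_ι]
      exact CliffordAlgebra.ι_mem_evenOdd_one _ _
  | add x y hx hy h1 h2 => rw [map_add]; exact add_mem h1 h2
  | ι_mul_ι_mul m₁ m₂ x hx ih =>
    erw [extDer_mul, extDer_mul, extDer_ι, extDer_ι]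
    rw [add_mul]
    exact add_mem (add_mem (hι _ _ _ hx) (hι _ _ _ hx)) (hι _ _ _ ih)

lemma ext_aug_odd (a : ExteriorAlgebra R M)
    (ha : a ∈ CliffordAlgebra.evenOdd (0 : QuadraticForm R M) 1) :
    ExteriorAlgebra.algebraMapInv a = 0 := by
  induction a, ha using CliffordAlgebra.odd_induction with
  | ι v => exact (ExteriorAlgebra.lift_ι_apply R _ _ v).trans rfl
  | add x y hx hy h1 h2 => rw [map_add, h1, h2, add_zero]
  | ι_mul_ι_mul m₁ m₂ x hx ih => rw [map_mul, ih, mul_zero]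

end Exterior

/-- A locally ringed space `(X, 𝒪_X)` over `ℂ`. -/
structure ComplexSpace where
  toLRS : AlgebraicGeometry.LocallyRingedSpace.{u}
  scalar : ℂ →+* toLRS.presheaf.obj (op ⊤)

namespace ComplexSpace

variable (X : ComplexSpace.{u})

/-- The underlying topological space. -/
abbrev top : TopCat.{u} := X.toLRS.toTopCat

/-- The ring `𝒪_X(U)`. -/
abbrev fn (U : Opens X.top) : Type u := X.toLRS.presheaf.obj (op U)

/-- The local ring `𝒪_{X,x}`. -/
abbrev loc (x : X.top) : Type u := X.toLRS.presheaf.stalk x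

/-- Restriction of functions. -/
def res {U V : Opens X.top} (h : V ≤ U) : X.fn U →+* X.fn V :=
  (X.toLRS.presheaf.map (homOfLE h).op).hom

/-- The germ of a function. -/
def germ {U : Opens X.top} (x : X.top) (hx : x ∈ U) : X.fn U →+* X.loc x :=
  (X.toLRS.presheaf.germ U x hx).hom

/-- The constant functions. -/
def const (U : Opens X.top) : ℂ →+* X.fn U := (X.res le_top).comp X.scalar

variable {X}

lemma germ_res {U V : Opens X.top} (h : V ≤ U) (x : X.top) (hx : x ∈ V) (f : X.fn U) :
    X.germ x hx (X.res h f) = X.germ x (h hx) f :=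
  TopCat.Presheaf.germ_res_apply X.toLRS.presheaf (homOfLE h) x hx f

lemma res_res {U V W : Opens X.top} (h : V ≤ U) (h' : W ≤ V) (f : X.fn U) :
    X.res h' (X.res h f) = X.res (h'.trans h) f := by
  simp only [res, ← RingHom.comp_apply, ← CommRingCat.hom_comp, ← Functor.map_comp]
  rfl

lemma res_const {U V : Opens X.top} (h : V ≤ U) (c : ℂ) :
    X.res h (X.const U c) = X.const V c := res_res _ _ _

lemma fn_ext {U : Opens X.top} (f g : X.fn U)
    (h : ∀ x (hx : x ∈ U), X.germ x hx f = X.germ x hx g) : f = g :=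
  TopCat.Presheaf.section_ext X.toLRS.sheaf U f g h

end ComplexSpace

/-- A superspace over `(X, 𝒪_X)`: a sheaf of supercommutative `ℂ`-algebras on `X`, augmented over
`𝒪_X`. -/
structure Superspace (X : ComplexSpace.{u}) where
  /-- The structure sheaf. -/
  sheaf : TopCat.Sheaf RingCat.{u} X.top
  scalar : ℂ →+* sheaf.presheaf.obj (op ⊤)
  /-- The even (`0`) and odd (`1`) sections. -/
  part : ∀ U : Opens X.top, ZMod 2 → AddSubgroup (sheaf.presheaf.obj (op U))
  isCompl : ∀ U, IsCompl (part U 0) (part U 1)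
  scalar_even : ∀ c, scalar c ∈ part ⊤ 0
  mul_mem : ∀ U i j f g, f ∈ part U i → g ∈ part U j → f * g ∈ part U (i + j)
  supercomm : ∀ U i j f g, f ∈ part U i → g ∈ part U j → f * g = (-1) ^ (i.val * j.val) * (g * f)
  res_mem : ∀ (U V : Opens X.top) (h : V ≤ U) i f, f ∈ part U i →
    (sheaf.presheaf.map (homOfLE h).op).hom f ∈ part V i
  /-- The augmentation. -/
  aug : ∀ U : Opens X.top, sheaf.presheaf.obj (op U) →+* X.fn U
  aug_res : ∀ (U V : Opens X.top) (h : V ≤ U) f,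
    aug V ((sheaf.presheaf.map (homOfLE h).op).hom f) = X.res h (aug U f)
  aug_scalar : ∀ c, aug ⊤ (scalar c) = X.scalar c
  aug_odd : ∀ U f, f ∈ part U 1 → aug U f = 0
  /-- The augmentation is an epimorphism of sheaves. -/
  aug_surj : ∀ (U : Opens X.top) (g : X.fn U) (x : X.top), x ∈ U →
    ∃ (V : Opens X.top) (h : V ≤ U) (f : sheaf.presheaf.obj (op V)), x ∈ V ∧ aug V f = X.res h g

namespace Superspace

variable {X : ComplexSpace.{u}} (𝔛 : Superspace X)

/-- The ring of sections of the structure sheaf over `U`. -/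
abbrev sec (U : Opens X.top) : Type u := 𝔛.sheaf.presheaf.obj (op U)

/-- The stalk of the structure sheaf at `x`. -/
abbrev stalk (x : X.top) : Type u := 𝔛.sheaf.presheaf.stalk x

/-- Restriction of sections. -/
def res {U V : Opens X.top} (h : V ≤ U) : 𝔛.sec U →+* 𝔛.sec V :=
  (𝔛.sheaf.presheaf.map (homOfLE h).op).hom

/-- The germ of a section. -/
def germ {U : Opens X.top} (x : X.top) (hx : x ∈ U) : 𝔛.sec U →+* 𝔛.stalk x :=
  (𝔛.sheaf.presheaf.germ U x hx).hom

/-- The constant sections. -/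
def const (U : Opens X.top) : ℂ →+* 𝔛.sec U := (𝔛.res le_top).comp 𝔛.scalar

variable {𝔛}

lemma germ_res {U V : Opens X.top} (h : V ≤ U) (x : X.top) (hx : x ∈ V) (f : 𝔛.sec U) :
    𝔛.germ x hx (𝔛.res h f) = 𝔛.germ x (h hx) f :=
  TopCat.Presheaf.germ_res_apply 𝔛.sheaf.presheaf (homOfLE h) x hx f

lemma exists_germ (x : X.top) (a : 𝔛.stalk x) :
    ∃ (U : Opens X.top) (hx : x ∈ U) (f : 𝔛.sec U), 𝔛.germ x hx f = a :=
  TopCat.Presheaf.exists_germ_eq 𝔛.sheaf.presheaf a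

lemma const_mem (U : Opens X.top) (c : ℂ) : 𝔛.const U c ∈ 𝔛.part U 0 :=
  𝔛.res_mem _ _ _ _ _ (𝔛.scalar_even c)

lemma const_commute (U : Opens X.top) (c : ℂ) (f : 𝔛.sec U) :
    𝔛.const U c * f = f * 𝔛.const U c := by
  have hf : f ∈ 𝔛.part U 0 ⊔ 𝔛.part U 1 := by
    rw [(𝔛.isCompl U).sup_eq_top]; trivial
  obtain ⟨a, ha, b, hb, rfl⟩ := AddSubgroup.mem_sup.1 hf
  have h0 := 𝔛.supercomm U 0 0 _ _ (𝔛.const_mem U c) ha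
  have h1 := 𝔛.supercomm U 0 1 _ _ (𝔛.const_mem U c) hb
  simp at h0 h1
  rw [mul_add, add_mul, h0, h1]

/-- Sections form a `ℂ`-algebra. -/
instance (U : Opens X.top) : Algebra ℂ (𝔛.sec U) :=
  (𝔛.const U).toAlgebra' (𝔛.const_commute U)

variable (𝔛)

/-- The augmentation, as a cocone over the sections near `x`. -/
def augCocone (x : X.top) :
    Limits.Cocone ((OpenNhds.inclusion x).op ⋙ 𝔛.sheaf.presheaf) where
  pt := RingCat.of (X.loc x)
  ι :=
    { app := fun V => RingCat.ofHom ((X.germ x V.unop.2).comp (𝔛.aug V.unop.1))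
      naturality := by
        intro V W i
        ext f
        have h : W.unop.1 ≤ V.unop.1 := leOfHom ((OpenNhds.inclusion x).map i.unop)
        have h1 := 𝔛.aug_res _ _ h f
        have h2 := X.germ_res h x W.unop.2 (𝔛.aug _ f)
        exact (congrArg (X.germ x W.unop.2) h1).trans h2 }

/-- The augmentation on stalks. -/
def stalkAug (x : X.top) : 𝔛.stalk x →+* X.loc x :=
  RingCat.Hom.hom (Limits.colimit.desc _ (𝔛.augCocone x))

variable {𝔛}

lemma stalkAug_germ {U : Opens X.top} (x : X.top) (hx : x ∈ U) (f : 𝔛.sec U) :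
    𝔛.stalkAug x (𝔛.germ x hx f) = X.germ x hx (𝔛.aug U f) :=
  congrArg (fun k => RingCat.Hom.hom k f)
    (Limits.colimit.ι_desc (𝔛.augCocone x) (op ⟨U, hx⟩))

lemma stalkAug_surjective (x : X.top) : Function.Surjective (𝔛.stalkAug x) := by
  intro r
  obtain ⟨U, hx, g, rfl⟩ : ∃ (U : Opens X.top) (hx : x ∈ U) (g : X.fn U), X.germ x hx g = r :=
    TopCat.Presheaf.exists_germ_eq X.toLRS.presheaf r
  obtain ⟨V, h, f, hxV, hf⟩ := 𝔛.aug_surj U g x hx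
  exact ⟨𝔛.germ x hxV f, by rw [stalkAug_germ, hf, X.germ_res]⟩

variable (𝔛)

/-- The stalk of the fermionic ideal `𝒥`. -/
def J (x : X.top) : Ideal (𝔛.stalk x) := RingHom.ker (𝔛.stalkAug x)

instance (x : X.top) : (𝔛.J x).IsTwoSided := inferInstanceAs (RingHom.ker _).IsTwoSided

/-- The sections over `U` of the ideal sheaf `𝒥 ^ m`. -/
def powJ (m : ℕ) (U : Opens X.top) : AddSubgroup (𝔛.sec U) where
  carrier := {f | ∀ x (hx : x ∈ U), 𝔛.germ x hx f ∈ 𝔛.J x ^ m}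
  zero_mem' x hx := by simp
  add_mem' hf hg x hx := by rw [map_add]; exact add_mem (hf x hx) (hg x hx)
  neg_mem' hf x hx := by rw [map_neg]; exact neg_mem (hf x hx)

/-- The stalk at `x` of the odd cotangent bundle `T*_{X,-} = 𝒥 / 𝒥²`. -/
def OddCot (x : X.top) : Type u :=
  (𝔛.J x) ⧸ Submodule.comap (𝔛.J x).subtype (𝔛.J x ^ 2)

instance (x : X.top) : AddCommGroup (𝔛.OddCot x) :=
  inferInstanceAs (AddCommGroup ((𝔛.J x) ⧸ Submodule.comap (𝔛.J x).subtype (𝔛.J x ^ 2)))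

instance (x : X.top) : Module (𝔛.stalk x) (𝔛.OddCot x) :=
  inferInstanceAs (Module _ ((𝔛.J x) ⧸ Submodule.comap (𝔛.J x).subtype (𝔛.J x ^ 2)))

/-- The quotient map `𝒥_x → 𝒥_x / 𝒥_x²`. -/
def cls (x : X.top) : 𝔛.J x →ₗ[𝔛.stalk x] 𝔛.OddCot x := Submodule.mkQ _

/-- The action of `𝒪_{X,x}` on `𝒥_x / 𝒥_x²`: lift to the stalk of the structure sheaf, then act. -/
instance (x : X.top) : SMul (X.loc x) (𝔛.OddCot x) :=
  ⟨fun r e => Function.surjInv (𝔛.stalkAug_surjective x) r • e⟩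

variable {𝔛} in
lemma cls_surjective (x : X.top) : Function.Surjective (𝔛.cls x) :=
  Submodule.mkQ_surjective _

variable {𝔛} in
lemma cls_eq_zero (x : X.top) (v : 𝔛.J x) : 𝔛.cls x v = 0 ↔ (v : 𝔛.stalk x) ∈ 𝔛.J x ^ 2 :=
  Submodule.Quotient.mk_eq_zero _

variable {𝔛} in
lemma stalkAug_smul (x : X.top) (a : 𝔛.stalk x) (e : 𝔛.OddCot x) :
    𝔛.stalkAug x a • e = a • e := by
  change Function.surjInv (𝔛.stalkAug_surjective x) (𝔛.stalkAug x a) • e = a • e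
  rw [← sub_eq_zero, ← sub_smul]
  have hb := Function.surjInv_eq (𝔛.stalkAug_surjective x) (𝔛.stalkAug x a)
  set b := Function.surjInv (𝔛.stalkAug_surjective x) (𝔛.stalkAug x a)
  have hab : b - a ∈ 𝔛.J x := by
    rw [J, RingHom.mem_ker, map_sub, hb, sub_self]
  obtain ⟨v, rfl⟩ := cls_surjective x e
  rw [← map_smul, cls_eq_zero, Submodule.pow_succ, Submodule.pow_one]
  exact Ideal.mul_mem_mul hab v.2

instance (x : X.top) : Module (X.loc x) (𝔛.OddCot x) :=
  Function.Surjective.moduleLeft (𝔛.stalkAug x) (𝔛.stalkAug_surjective x)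
    (stalkAug_smul x)

/-- The stalk `⋀_{𝒪_{X,x}} (𝒥_x / 𝒥_x²)` of the structure sheaf of the split model. -/
abbrev Ext (x : X.top) : Type u := ExteriorAlgebra (X.loc x) (𝔛.OddCot x)

/-! ### Supermanifolds -/

/-- An isomorphism of augmented superalgebras between the structure sheaf over `V` and
`⋀_{𝒪_X} 𝒪_X^q`. The presheaf `W ↦ ⋀_{𝒪_X(W)} 𝒪_X(W)^q` is a sheaf, whose restriction maps are
determined by their values on functions and on the standard generators. -/
structure LocalTrivialization (q : ℕ) (V : Opens X.top) where
  equiv : ∀ W : Opens X.top, W ≤ V → (ExteriorAlgebra (X.fn W) (Fin q → X.fn W) ≃+* 𝔛.sec W)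
  res_fn : ∀ W W' (hW : W ≤ V) (h : W' ≤ W) (g : X.fn W),
    𝔛.res h (equiv W hW (algebraMap _ _ g)) = equiv W' (h.trans hW) (algebraMap _ _ (X.res h g))
  res_gen : ∀ W W' (hW : W ≤ V) (h : W' ≤ W) (i : Fin q),
    𝔛.res h (equiv W hW (ExteriorAlgebra.ι _ (Pi.single i 1))) =
      equiv W' (h.trans hW) (ExteriorAlgebra.ι _ (Pi.single i 1))
  const : ∀ W hW c, equiv W hW (algebraMap _ _ (X.const W c)) = 𝔛.const W c
  parity : ∀ W hW i z,
    z ∈ CliffordAlgebra.evenOdd (0 : QuadraticForm (X.fn W) (Fin q → X.fn W)) i →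
      equiv W hW z ∈ 𝔛.part W i
  aug : ∀ W hW z, 𝔛.aug W (equiv W hW z) = ExteriorAlgebra.algebraMapInv z

/-- `𝔛` is a supermanifold of odd dimension `q`: its structure sheaf is locally isomorphic to
the exterior algebra of a locally free `𝒪_X`-module of rank `q`. -/
def IsSupermanifold (q : ℕ) : Prop :=
  ∀ x : X.top, ∃ V : Opens X.top, x ∈ V ∧ Nonempty (𝔛.LocalTrivialization q V)

/-! ### Isomorphisms and vector fields -/

/-- An even isomorphism of superspaces over the identity of `(X, 𝒪_X)`. -/
@[ext]
structure Iso (𝔜 : Superspace X) where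
  toEquiv : ∀ U : Opens X.top, 𝔛.sec U ≃ₐ[ℂ] 𝔜.sec U
  res : ∀ (U V : Opens X.top) (h : V ≤ U) f, toEquiv V (𝔛.res h f) = 𝔜.res h (toEquiv U f)
  parity : ∀ U i f, f ∈ 𝔛.part U i → toEquiv U f ∈ 𝔜.part U i
  aug : ∀ U f, 𝔜.aug U (toEquiv U f) = 𝔛.aug U f

/-- A global section of parity `p` of the sheaf of `ℂ`-linear superderivations of the structure
sheaf. -/
structure SuperDerivation (p : ZMod 2) where
  toFun : ∀ U : Opens X.top, 𝔛.sec U →ₗ[ℂ] 𝔛.sec U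
  res : ∀ (U V : Opens X.top) (h : V ≤ U) f, toFun V (𝔛.res h f) = 𝔛.res h (toFun U f)
  parity : ∀ U i f, f ∈ 𝔛.part U i → toFun U f ∈ 𝔛.part U (p + i)
  leibniz : ∀ U i f g, f ∈ 𝔛.part U i →
    toFun U (f * g) = toFun U f * g + (-1) ^ (p.val * i.val) * (f * toFun U g)

/-- A global vector field: a global section of `T_𝔛 = T_{𝔛,+} ⊕ T_{𝔛,-}`. -/
structure VectorField where
  even : 𝔛.SuperDerivation 0
  odd : 𝔛.SuperDerivation 1

variable {𝔛} in
/-- The operator by which a vector field acts on sections. -/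
def VectorField.act (H : 𝔛.VectorField) (U : Opens X.top) : 𝔛.sec U →ₗ[ℂ] 𝔛.sec U :=
  H.even.toFun U + H.odd.toFun U

/-! ### The split model -/

variable {𝔛} in
/-- The function with values in the stalks `⋀ (𝒥_x / 𝒥_x²)` given by a function on `V`. -/
def ofFn {V : Opens X.top} (g : X.fn V) (x : V) : 𝔛.Ext x.1 :=
  algebraMap (X.loc x.1) (𝔛.Ext x.1) (X.germ x.1 x.2 g)

variable {𝔛} in
/-- The function with values in the stalks `⋀ (𝒥_x / 𝒥_x²)` given by the class of a section
of `𝒥` over `V`. -/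
def ofOdd {V : Opens X.top} (f : 𝔛.sec V) (hf : ∀ x (hx : x ∈ V), 𝔛.germ x hx f ∈ 𝔛.J x)
    (x : V) : 𝔛.Ext x.1 :=
  ExteriorAlgebra.ι (X.loc x.1) (𝔛.cls x.1 ⟨𝔛.germ x.1 x.2 f, hf x.1 x.2⟩)

/-- The functions on `V` with values in the stalks `⋀ (𝒥_x / 𝒥_x²)` generated by the
functions on `V` and the classes of the sections of `𝒥` over `V`. -/
def splitGen (V : Opens X.top) : Subring (∀ x : V, 𝔛.Ext x.1) :=
  Subring.closure ({s | ∃ g : X.fn V, s = ofFn g} ∪ {s | ∃ f hf, s = ofOdd f hf})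

/-- Restriction of functions with values in the stalks. -/
def piRes {U V : Opens X.top} (h : V ≤ U) : (∀ x : U, 𝔛.Ext x) →+* (∀ x : V, 𝔛.Ext x) where
  toFun s x := s ⟨x.1, h x.2⟩
  map_one' := rfl
  map_mul' _ _ := rfl
  map_zero' := rfl
  map_add' _ _ := rfl

variable {𝔛} in
lemma splitGen_res {U V : Opens X.top} (h : V ≤ U) {s : ∀ x : U, 𝔛.Ext x}
    (hs : s ∈ 𝔛.splitGen U) : 𝔛.piRes h s ∈ 𝔛.splitGen V := by
  have : 𝔛.splitGen U ≤ (𝔛.splitGen V).comap (𝔛.piRes h) := by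
    refine Subring.closure_le.2 ?_
    rintro s (⟨g, rfl⟩ | ⟨f, hf, rfl⟩)
    · refine Subring.subset_closure (Or.inl ⟨X.res h g, ?_⟩)
      funext x
      exact congrArg (algebraMap (X.loc x.1) (𝔛.Ext x.1)) (X.germ_res h x.1 x.2 g).symm
    · refine Subring.subset_closure (Or.inr ⟨𝔛.res h f, fun x hx => ?_, ?_⟩)
      · rw [germ_res]; exact hf x (h hx)
      · funext x
        exact congrArg (fun v => ExteriorAlgebra.ι (X.loc x.1) (𝔛.cls x.1 v))
          (Subtype.ext (germ_res h x.1 x.2 f).symm)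
  exact this hs

/-- The local predicate on functions with values in the stalks: being locally generated by
functions and classes of sections of `𝒥`. -/
def splitPred : TopCat.LocalPredicate (X := X.top) (fun x => 𝔛.Ext x) :=
  TopCat.PrelocalPredicate.sheafify
    { pred := fun {V} s => s ∈ 𝔛.splitGen V
      res := fun i _ hs => splitGen_res (leOfHom i) hs }

variable {𝔛} in
lemma splitPred_op₂ (op : ∀ V : Opens X.top, (∀ x : V, 𝔛.Ext x) → (∀ x : V, 𝔛.Ext x) →
      (∀ x : V, 𝔛.Ext x))
    (hres : ∀ U V (h : V ≤ U) s t, 𝔛.piRes h (op U s t) = op V (𝔛.piRes h s) (𝔛.piRes h t))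
    (hop : ∀ V s t, s ∈ 𝔛.splitGen V → t ∈ 𝔛.splitGen V → op V s t ∈ 𝔛.splitGen V)
    {U : Opens X.top} {s t : ∀ x : U, 𝔛.Ext x} (hs : 𝔛.splitPred.pred s)
    (ht : 𝔛.splitPred.pred t) : 𝔛.splitPred.pred (op U s t) := by
  intro x
  obtain ⟨V, hV, i, h⟩ := hs x
  obtain ⟨W, hW, j, h'⟩ := ht x
  refine ⟨V ⊓ W, ⟨hV, hW⟩, homOfLE (inf_le_left.trans (leOfHom i)), ?_⟩
  have := hop (V ⊓ W) _ _ (splitGen_res inf_le_left h) (splitGen_res inf_le_right h')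
  exact ((congrArg (fun r => r ∈ 𝔛.splitGen (V ⊓ W))
    (hres U (V ⊓ W) (inf_le_left.trans (leOfHom i)) s t)).mpr this)

/-- The sections over `U` of the sheaf `⋀_{𝒪_X} T*_{X,-}`. -/
def splitSec (U : Opens X.top) : Subring (∀ x : U, 𝔛.Ext x) where
  carrier := {s | 𝔛.splitPred.pred s}
  zero_mem' := TopCat.PrelocalPredicate.sheafifyOf (zero_mem (𝔛.splitGen U))
  one_mem' := TopCat.PrelocalPredicate.sheafifyOf (one_mem (𝔛.splitGen U))
  add_mem' := splitPred_op₂ (fun _ s t => s + t) (fun _ _ _ _ _ => rfl)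
    (fun _ _ _ => add_mem)
  mul_mem' := splitPred_op₂ (fun _ s t => s * t) (fun _ _ _ _ _ => rfl)
    (fun V _ _ => Subring.mul_mem (𝔛.splitGen V))
  neg_mem' hs := splitPred_op₂ (fun _ s _ => -s) (fun _ _ _ _ _ => rfl)
    (fun _ _ _ h _ => neg_mem h) hs hs

/-- The presheaf of rings `⋀_{𝒪_X} T*_{X,-}`. -/
def splitPresheaf : TopCat.Presheaf RingCat.{u} X.top where
  obj U := RingCat.of (𝔛.splitSec U.unop)
  map i := RingCat.ofHom
    (((𝔛.piRes (leOfHom i.unop)).comp (𝔛.splitSec _).subtype).codRestrict (𝔛.splitSec _)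
      (fun s => 𝔛.splitPred.res i.unop s.1 s.2))

lemma splitPresheaf_isSheaf : 𝔛.splitPresheaf.IsSheaf := by
  rw [TopCat.Presheaf.isSheaf_iff_isSheaf_comp (forget RingCat)]
  exact TopCat.Presheaf.isSheaf_of_iso (NatIso.ofComponents (fun _ => Iso.refl _))
    (TopCat.subpresheafToTypes.isSheaf 𝔛.splitPred)

variable {𝔛} in
lemma ofFn_mem {U : Opens X.top} (g : X.fn U) : ofFn g ∈ 𝔛.splitSec U :=
  TopCat.PrelocalPredicate.sheafifyOf (Subring.subset_closure (Or.inl ⟨g, rfl⟩))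

/-- Functions as sections of `⋀_{𝒪_X} T*_{X,-}`. -/
def fnHom (U : Opens X.top) : X.fn U →+* 𝔛.splitSec U where
  toFun g := ⟨ofFn g, ofFn_mem g⟩
  map_one' := Subtype.ext (funext fun x => by simp [ofFn])
  map_mul' a b := Subtype.ext (funext fun x => by simp [ofFn])
  map_zero' := Subtype.ext (funext fun x => by simp [ofFn])
  map_add' a b := Subtype.ext (funext fun x => by simp [ofFn])

variable {𝔛} in
lemma splitSec_map (φ : ∀ x : X.top, 𝔛.Ext x → 𝔛.Ext x)
    (hφ : ∀ V, ∀ s ∈ 𝔛.splitGen V, (fun x : V => φ x (s x)) ∈ 𝔛.splitGen V)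
    {U : Opens X.top} {s : ∀ x : U, 𝔛.Ext x} (hs : s ∈ 𝔛.splitSec U) :
    (fun x : U => φ x (s x)) ∈ 𝔛.splitSec U :=
  fun x =>
    let ⟨V, hV, i, h⟩ := hs x
    ⟨V, hV, i, hφ V _ h⟩

variable {𝔛} in
lemma splitSec_involute {U : Opens X.top} {s : ∀ x : U, 𝔛.Ext x} (hs : s ∈ 𝔛.splitSec U) :
    (fun x : U => CliffordAlgebra.involute (s x)) ∈ 𝔛.splitSec U := by
  refine splitSec_map (fun x a => CliffordAlgebra.involute a) (fun V s hs => ?_) hs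
  induction hs using Subring.closure_induction with
  | mem s hs =>
    obtain ⟨g, rfl⟩ | ⟨f, hf, rfl⟩ := hs
    · refine Subring.subset_closure (Or.inl ⟨g, funext fun x => ?_⟩)
      exact AlgHom.commutes _ _
    · have : (fun x : V => CliffordAlgebra.involute (ofOdd f hf x)) = -ofOdd f hf :=
        funext fun x => CliffordAlgebra.involute_ι _
      rw [this]
      exact neg_mem (Subring.subset_closure (Or.inr ⟨f, hf, rfl⟩))
  | zero =>
    have : (fun x : V => CliffordAlgebra.involute ((0 : ∀ x : V, 𝔛.Ext x) x)) = 0 := funext fun x => map_zero _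
    rw [this]; exact zero_mem _
  | one =>
    have : (fun x : V => CliffordAlgebra.involute ((1 : ∀ x : V, 𝔛.Ext x) x)) = 1 := funext fun x => map_one _
    rw [this]; exact one_mem _
  | add s t _ _ h h' =>
    have : (fun x : V => CliffordAlgebra.involute ((s + t) x)) =
        (fun x : V => CliffordAlgebra.involute (s x)) + (fun x : V => CliffordAlgebra.involute (t x)) :=
      funext fun x => map_add _ _ _
    rw [this]; exact add_mem h h'
  | neg s _ h =>
    have : (fun x : V => CliffordAlgebra.involute ((-s) x)) = -(fun x : V => CliffordAlgebra.involute (s x)) :=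
      funext fun x => map_neg _ _
    rw [this]; exact neg_mem h
  | mul s t _ _ h h' =>
    have : (fun x : V => CliffordAlgebra.involute ((s * t) x)) =
        (fun x : V => CliffordAlgebra.involute (s x)) * (fun x : V => CliffordAlgebra.involute (t x)) :=
      funext fun x => map_mul _ _ _
    rw [this]; exact Subring.mul_mem _ h h'

variable {𝔛} in
lemma splitSec_der {U : Opens X.top} {s : ∀ x : U, 𝔛.Ext x} (hs : s ∈ 𝔛.splitSec U) :
    (fun x : U => extDer LinearMap.id (s x)) ∈ 𝔛.splitSec U := by
  refine splitSec_map (fun x a => extDer LinearMap.id a) (fun V s hs => ?_) hs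
  induction hs using Subring.closure_induction with
  | mem s hs =>
    obtain ⟨g, rfl⟩ | ⟨f, hf, rfl⟩ := hs
    · have : (fun x : V => extDer LinearMap.id (ofFn (𝔛 := 𝔛) g x)) = 0 :=
        funext fun x => extDer_algebraMap _ _
      rw [this]; exact zero_mem _
    · have : (fun x : V => extDer LinearMap.id (ofOdd f hf x)) = ofOdd f hf :=
        funext fun x => extDer_ι _ _
      rw [this]
      exact Subring.subset_closure (Or.inr ⟨f, hf, rfl⟩)
  | zero =>
    have : (fun x : V => extDer LinearMap.id ((0 : ∀ x : V, 𝔛.Ext x) x)) = 0 := funext fun x => map_zero _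
    rw [this]; exact zero_mem _
  | one =>
    have : (fun x : V => extDer LinearMap.id ((1 : ∀ x : V, 𝔛.Ext x) x)) = 0 :=
      funext fun x => by
        have := extDer_algebraMap (LinearMap.id (R := X.loc x) (M := 𝔛.OddCot x)) 1
        rwa [map_one] at this
    rw [this]; exact zero_mem _
  | add s t _ _ h h' =>
    have : (fun x : V => extDer LinearMap.id ((s + t) x)) =
        (fun x : V => extDer LinearMap.id (s x)) + (fun x : V => extDer LinearMap.id (t x)) :=
      funext fun x => map_add _ _ _
    rw [this]; exact add_mem h h'
  | neg s _ h =>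
    have : (fun x : V => extDer LinearMap.id ((-s) x)) = -(fun x : V => extDer LinearMap.id (s x)) :=
      funext fun x => map_neg _ _
    rw [this]; exact neg_mem h
  | mul s t hs ht h h' =>
    have : (fun x : V => extDer LinearMap.id ((s * t) x)) =
        (fun x : V => extDer LinearMap.id (s x)) * t +
          s * (fun x : V => extDer LinearMap.id (t x)) :=
      funext fun x => extDer_mul _ _ _
    rw [this]
    exact add_mem (Subring.mul_mem _ h ht) (Subring.mul_mem _ hs h')

variable {𝔛} in
lemma splitSec_aug {U : Opens X.top} (s : 𝔛.splitSec U) :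
    ∃ g : X.fn U, ∀ x : U, X.germ x.1 x.2 g = ExteriorAlgebra.algebraMapInv (s.1 x) := by
  have hgen : ∀ V, ∀ s ∈ 𝔛.splitGen V, ∃ g : X.fn V, ∀ x : V,
      X.germ x.1 x.2 g = ExteriorAlgebra.algebraMapInv (s x) := by
    intro V s hs
    induction hs using Subring.closure_induction with
    | mem s hs =>
      obtain ⟨g, rfl⟩ | ⟨f, hf, rfl⟩ := hs
      · exact ⟨g, fun x => (ExteriorAlgebra.algebraMap_leftInverse _ _).symm⟩
      · exact ⟨0, fun x => by simp [ofOdd, ExteriorAlgebra.algebraMapInv]⟩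
    | zero => exact ⟨0, fun x => by simp⟩
    | one => exact ⟨1, fun x => by simp⟩
    | add s t _ _ h h' =>
      obtain ⟨a, ha⟩ := h
      obtain ⟨b, hb⟩ := h'
      exact ⟨a + b, fun x => by simp [ha, hb]⟩
    | neg s _ h =>
      obtain ⟨a, ha⟩ := h
      exact ⟨-a, fun x => by simp [ha]⟩
    | mul s t _ _ h h' =>
      obtain ⟨a, ha⟩ := h
      obtain ⟨b, hb⟩ := h'
      exact ⟨a * b, fun x => by simp [ha, hb]⟩
  choose V hV i h using s.2
  choose g hg using fun x => hgen _ _ (h x)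
  obtain ⟨G, hG, -⟩ := TopCat.Sheaf.existsUnique_gluing' X.toLRS.sheaf V U i
    (fun x hx => Opens.mem_iSup.2 ⟨⟨x, hx⟩, hV ⟨x, hx⟩⟩) g (by
      intro a b
      refine ComplexSpace.fn_ext _ _ fun x hx => ?_
      have h1 := X.germ_res (inf_le_left : V a ⊓ V b ≤ V a) x hx (g a)
      have h2 := X.germ_res (inf_le_right : V a ⊓ V b ≤ V b) x hx (g b)
      exact (h1.trans (hg a ⟨x, hx.1⟩)).trans (h2.trans (hg b ⟨x, hx.2⟩)).symm)
  refine ⟨G, fun x => ?_⟩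
  have h1 := X.germ_res (leOfHom (i x)) x.1 (hV x) G
  rw [← h1]
  have h2 : X.res (leOfHom (i x)) G = g x := hG x
  rw [h2]
  exact hg x ⟨x.1, hV x⟩

/-- The projection of `⋀_{𝒪_X} T*_{X,-}` onto its degree zero component `𝒪_X`. -/
def splitAug (U : Opens X.top) : 𝔛.splitSec U →+* X.fn U where
  toFun s := (splitSec_aug s).choose
  map_one' := ComplexSpace.fn_ext _ _ fun x hx => by
    rw [(splitSec_aug (1 : 𝔛.splitSec U)).choose_spec ⟨x, hx⟩]; simp
  map_zero' := ComplexSpace.fn_ext _ _ fun x hx => by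
    rw [(splitSec_aug (0 : 𝔛.splitSec U)).choose_spec ⟨x, hx⟩]; simp
  map_mul' s t := ComplexSpace.fn_ext _ _ fun x hx => by
    rw [map_mul, (splitSec_aug (s * t)).choose_spec ⟨x, hx⟩, (splitSec_aug s).choose_spec ⟨x, hx⟩,
      (splitSec_aug t).choose_spec ⟨x, hx⟩]; simp
  map_add' s t := ComplexSpace.fn_ext _ _ fun x hx => by
    rw [map_add, (splitSec_aug (s + t)).choose_spec ⟨x, hx⟩, (splitSec_aug s).choose_spec ⟨x, hx⟩,
      (splitSec_aug t).choose_spec ⟨x, hx⟩]; simp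

variable {𝔛} in
lemma germ_splitAug {U : Opens X.top} (s : 𝔛.splitSec U) (x : X.top) (hx : x ∈ U) :
    X.germ x hx (𝔛.splitAug U s) = ExteriorAlgebra.algebraMapInv (s.1 ⟨x, hx⟩) :=
  (splitSec_aug s).choose_spec ⟨x, hx⟩

/-- The sections of parity `i` of `⋀_{𝒪_X} T*_{X,-}`. -/
def splitPart (U : Opens X.top) (i : ZMod 2) : AddSubgroup (𝔛.splitSec U) where
  carrier := {s | ∀ x : U, s.1 x ∈
    CliffordAlgebra.evenOdd (0 : QuadraticForm (X.loc x.1) (𝔛.OddCot x.1)) i}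
  zero_mem' _ := zero_mem _
  add_mem' h h' x := add_mem (h x) (h' x)
  neg_mem' h x := neg_mem (h x)

lemma splitPart_isCompl (U : Opens X.top) : IsCompl (𝔛.splitPart U 0) (𝔛.splitPart U 1) := by
  constructor
  · rw [disjoint_iff, eq_bot_iff]
    rintro s ⟨h0, h1⟩
    refine Subtype.ext (funext fun x => ?_)
    have := (CliffordAlgebra.evenOdd_isCompl
      (Q := (0 : QuadraticForm (X.loc x.1) (𝔛.OddCot x.1)))).disjoint
    exact Submodule.disjoint_def.1 this _ (h0 x) (h1 x)
  · rw [codisjoint_iff, eq_top_iff]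
    intro s _
    have hhalf : X.const U (1 / 2) + X.const U (1 / 2) = 1 := by
      rw [← map_add]; norm_num
    let t : 𝔛.splitSec U := ⟨_, splitSec_involute s.2⟩
    refine AddSubgroup.mem_sup.2 ⟨𝔛.fnHom U (X.const U (1 / 2)) * (s + t), fun x => ?_,
      𝔛.fnHom U (X.const U (1 / 2)) * (s - t), fun x => ?_, ?_⟩
    · obtain ⟨a, ha, b, hb, hab⟩ := Submodule.mem_sup.1
        ((CliffordAlgebra.evenOdd_isCompl
          (Q := (0 : QuadraticForm (X.loc x.1) (𝔛.OddCot x.1)))).sup_eq_top ▸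
            (Submodule.mem_top : s.1 x ∈ _))
      have h1 : s.1 x + t.1 x = a + a := by
        change s.1 x + CliffordAlgebra.involute (s.1 x) = a + a
        rw [← hab, map_add, CliffordAlgebra.involute_eq_of_mem_even ha,
          CliffordAlgebra.involute_eq_of_mem_odd hb]
        abel
      change algebraMap _ _ _ * (s.1 x + t.1 x) ∈ _
      rw [h1, ← Algebra.smul_def]
      exact Submodule.smul_mem _ _ (add_mem ha ha)
    · obtain ⟨a, ha, b, hb, hab⟩ := Submodule.mem_sup.1
        ((CliffordAlgebra.evenOdd_isCompl
          (Q := (0 : QuadraticForm (X.loc x.1) (𝔛.OddCot x.1)))).sup_eq_top ▸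
            (Submodule.mem_top : s.1 x ∈ _))
      have h1 : s.1 x - t.1 x = b + b := by
        change s.1 x - CliffordAlgebra.involute (s.1 x) = b + b
        rw [← hab, map_add, CliffordAlgebra.involute_eq_of_mem_even ha,
          CliffordAlgebra.involute_eq_of_mem_odd hb]
        abel
      change algebraMap _ _ _ * (s.1 x - t.1 x) ∈ _
      rw [h1, ← Algebra.smul_def]
      exact Submodule.smul_mem _ _ (add_mem hb hb)
    · have h2 : 𝔛.fnHom U (X.const U (1 / 2)) + 𝔛.fnHom U (X.const U (1 / 2)) = 1 := by
        rw [← map_add, hhalf, map_one]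
      calc _ = (𝔛.fnHom U (X.const U (1 / 2)) + 𝔛.fnHom U (X.const U (1 / 2))) * s := by
            noncomm_ring
        _ = s := by rw [h2, one_mul]

/-- The split model `(X, ⋀_{𝒪_X} T*_{X,-})` of `𝔛`. -/
def splitModel : Superspace X where
  sheaf := ⟨𝔛.splitPresheaf, 𝔛.splitPresheaf_isSheaf⟩
  scalar := (𝔛.fnHom ⊤).comp X.scalar
  part := 𝔛.splitPart
  isCompl := 𝔛.splitPart_isCompl
  scalar_even c x := SetLike.algebraMap_mem_graded
    (CliffordAlgebra.evenOdd (0 : QuadraticForm (X.loc x.1) (𝔛.OddCot x.1))) _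
  mul_mem U i j s t hs ht x := SetLike.mul_mem_graded
    (A := CliffordAlgebra.evenOdd (0 : QuadraticForm (X.loc x.1) (𝔛.OddCot x.1))) (hs x) (ht x)
  supercomm U i j s t hs ht := by
    refine Subtype.ext (funext fun x => ?_)
    have h1 : ((-1) ^ (i.val * j.val) : 𝔛.splitSec U).1 x = (-1) ^ (i.val * j.val) := by
      simp
    change s.1 x * t.1 x = ((-1) ^ (i.val * j.val) : 𝔛.splitSec U).1 x * (t.1 x * s.1 x)
    rw [h1]
    exact ext_supercomm i j _ _ (hs x) (ht x)
  res_mem U V h i s hs x := hs ⟨x.1, h x.2⟩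
  aug := 𝔛.splitAug
  aug_res U V h s := ComplexSpace.fn_ext _ _ fun x hx => by
    rw [X.germ_res]
    exact (germ_splitAug _ x hx).trans (germ_splitAug s x (h hx)).symm
  aug_scalar c := ComplexSpace.fn_ext _ _ fun x hx =>
    (germ_splitAug _ x hx).trans (ExteriorAlgebra.algebraMap_leftInverse _ _)
  aug_odd U s hs := ComplexSpace.fn_ext _ _ fun x hx => by
    rw [map_zero]
    exact (germ_splitAug s x hx).trans (ext_aug_odd _ (hs ⟨x, hx⟩))
  aug_surj U g x hx := ⟨U, le_rfl, 𝔛.fnHom U g, hx, ComplexSpace.fn_ext _ _ fun y hy => by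
    rw [X.germ_res]
    exact (germ_splitAug _ y hy).trans (ExteriorAlgebra.algebraMap_leftInverse _ _)⟩

variable {𝔛} in
/-- The value at `x` of a section of the structure sheaf of the split model. -/
def splitVal {U : Opens X.top} (s : 𝔛.splitModel.sec U) (x : X.top) (hx : x ∈ U) : 𝔛.Ext x :=
  Subtype.val (p := fun t => t ∈ 𝔛.splitSec U) s ⟨x, hx⟩

variable {𝔛} in
lemma splitSec_ext {U : Opens X.top} {s t : 𝔛.splitModel.sec U}
    (h : ∀ x hx, splitVal s x hx = splitVal t x hx) : s = t :=
  Subtype.ext (p := fun t => t ∈ 𝔛.splitSec U) (funext fun x => h x.1 x.2)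

variable {𝔛} in
lemma splitVal_smul {U : Opens X.top} (c : ℂ) (s : 𝔛.splitModel.sec U) {x : X.top} (hx : x ∈ U) :
    splitVal (c • s) x hx =
      algebraMap (X.loc x) (𝔛.Ext x) (X.germ x hx (X.const U c)) * splitVal s x hx := by
  have h : X.germ x hx (X.const U c) =
      X.germ x (show x ∈ (⊤ : Opens X.top) from trivial) (X.scalar c) := X.germ_res _ _ _ _
  rw [h, Algebra.smul_def]
  rfl

/-- The zero superderivation. -/
def SuperDerivation.zero (p : ZMod 2) : 𝔛.SuperDerivation p where
  toFun _ := 0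
  res U V h f := by simp
  parity U i f _ := zero_mem _
  leibniz U i f g _ := by simp

/-- The Euler vector field on sections: on stalks, the `𝒪_{X,x}`-linear derivation of
`⋀ (𝒥_x / 𝒥_x²)` which extends the identity of `𝒥_x / 𝒥_x²`. -/
def eulerFun {U : Opens X.top} (s : 𝔛.splitModel.sec U) : 𝔛.splitModel.sec U :=
  (⟨fun x => extDer LinearMap.id (splitVal s x.1 x.2),
    splitSec_der (Subtype.property (p := fun t => t ∈ 𝔛.splitSec U) s)⟩ : 𝔛.splitSec U)

lemma splitVal_eulerFun {U : Opens X.top} (s : 𝔛.splitModel.sec U) (x : X.top) (hx : x ∈ U) :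
    splitVal (𝔛.eulerFun s) x hx = extDer LinearMap.id (splitVal s x hx) := rfl

variable {𝔛} in
lemma splitVal_add {U : Opens X.top} (s t : 𝔛.splitModel.sec U) (x : X.top) (hx : x ∈ U) :
    splitVal (s + t) x hx = splitVal s x hx + splitVal t x hx := rfl

variable {𝔛} in
lemma splitVal_mul {U : Opens X.top} (s t : 𝔛.splitModel.sec U) (x : X.top) (hx : x ∈ U) :
    splitVal (s * t) x hx = splitVal s x hx * splitVal t x hx := rfl

/-- The Euler vector field on sections, as a `ℂ`-linear map. -/
def eulerLin (U : Opens X.top) : 𝔛.splitModel.sec U →ₗ[ℂ] 𝔛.splitModel.sec U where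
  toFun := 𝔛.eulerFun
  map_add' s t := splitSec_ext fun x hx => by
    rw [splitVal_eulerFun, splitVal_add, splitVal_add, map_add, splitVal_eulerFun,
      splitVal_eulerFun]
  map_smul' c s := splitSec_ext fun x hx => by
    rw [RingHom.id_apply, splitVal_eulerFun, splitVal_smul, splitVal_smul, splitVal_eulerFun,
      ← Algebra.smul_def, ← Algebra.smul_def, map_smul]

/-- The Euler vector field of the split model. -/
def euler : 𝔛.splitModel.VectorField where
  even :=
    { toFun := 𝔛.eulerLin
      res := fun U V h s => rfl
      parity := fun U i s hs x => by
        rw [zero_add]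
        exact extDer_parity _ _ _ (hs x)
      leibniz := fun U i s t _ => splitSec_ext fun x hx => by
        rw [ZMod.val_zero, zero_mul, pow_zero, one_mul]
        exact extDer_mul _ _ _ }
  odd := SuperDerivation.zero _ _

/-! ### Initial forms -/

/-- The graph of the canonical map `𝒥_x ^ m → 𝒥_x ^ m / 𝒥_x ^ (m + 1) ≅ ⋀^m (𝒥_x / 𝒥_x²)`, with
`c v₁ ⋯ v_m ↦ c [v₁] ∧ ⋯ ∧ [v_m]`. -/
def symbol (x : X.top) (m : ℕ) : AddSubgroup (𝔛.stalk x × 𝔛.Ext x) :=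
  AddSubgroup.closure
    ({p | ∃ (c : 𝔛.stalk x) (v : Fin m → 𝔛.J x),
        p = (c * (List.ofFn fun i => (v i : 𝔛.stalk x)).prod,
          𝔛.stalkAug x c • ExteriorAlgebra.ιMulti (X.loc x) m fun i => 𝔛.cls x (v i))} ∪
     {p | p.1 ∈ 𝔛.J x ^ (m + 1) ∧ p.2 = 0})

variable {𝔛} in
/-- `H` lies in the stratum `T^{(0)}`, i.e. `H(𝒥^m) ⊆ 𝒥^m` for all `m`. -/
def VectorField.IsDegreeZero (H : 𝔛.VectorField) : Prop :=
  ∀ m U, ∀ f ∈ 𝔛.powJ m U, H.act U f ∈ 𝔛.powJ m U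

variable {𝔛} in
/-- `H` lies in the stratum `T^{(0)}`, and `ν` is its class in `T^{(0)} / T^{(1)} ≅ T^{0}`, the
degree zero vector fields on the split model: if `f` in `𝒥^m` has class `s` in `⋀^m T*_{X,-}`, then
`H f` has class `ν s`. -/
def VectorField.HasInitialForm (H : 𝔛.VectorField) (ν : 𝔛.splitModel.VectorField) : Prop :=
  H.IsDegreeZero ∧
  ∀ m U (f : 𝔛.sec U) (s : 𝔛.splitModel.sec U),
    (∀ x hx, (𝔛.germ x hx f, splitVal s x hx) ∈ 𝔛.symbol x m) →
      ∀ x hx, (𝔛.germ x hx (H.act U f), splitVal (ν.act U s) x hx) ∈ 𝔛.symbol x m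

/-! ### Splitting operators -/

/-- The polynomial `(1 / q!) (1 - t)(2 - t) ⋯ (q - t)`. -/
def splitPoly₁ (q : ℕ) : Polynomial ℂ :=
  Polynomial.C (q.factorial : ℂ)⁻¹ *
    ∏ j ∈ Finset.Icc 1 q, (Polynomial.C (j : ℂ) - Polynomial.X)

/-- The polynomial `(1 / (q - 1)!) (2 - t)(3 - t) ⋯ (q - t)`. -/
def splitPoly₂ (q : ℕ) : Polynomial ℂ :=
  Polynomial.C ((q - 1).factorial : ℂ)⁻¹ *
    ∏ j ∈ Finset.Icc 2 q, (Polynomial.C (j : ℂ) - Polynomial.X)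

variable {𝔛} in
/-- The operator `P(D)` on sections. -/
def polyOp (P : Polynomial ℂ) {U : Opens X.top} (D : 𝔛.sec U →ₗ[ℂ] 𝔛.sec U) :
    𝔛.sec U →ₗ[ℂ] 𝔛.sec U :=
  Polynomial.aeval (R := ℂ) (A := Module.End ℂ (𝔛.sec U)) D P

end Superspace

end

/-! ### Filtered rings -/

section Filtered

variable {A : Type*} [Ring A] {J : Ideal A}

/-! The argument is an eigenvalue calculus on the filtration by powers of `𝒥`. The initial form says
that `H` acts by `0` on `𝒪/𝒥` and by `1` on `𝒥/𝒥²`. Conjugating `H = H₊ + H₋` by the parity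
involution gives `H₊ - H₋`, and `2` is invertible, so `H₊` has the same two eigenvalues while `H₋`
raises the filtration by one on `𝒪` and on `𝒥`. By the Leibniz rules, `H₊` and `H` then act by `m`
on every `𝒥^m/𝒥^(m+1)` (`derivation_sub_mem_pow`, `twistedDerivation_mem_pow`,
`VectorField.act_filtered`).

Hence a polynomial `P(H)` acts by `P(m)` on `𝒥^m/𝒥^(m+1)` (`aeval_sub_mem`), and the factor `j - H`
maps `𝒥^j` into `𝒥^(j+1)` (`aeval_prod_mem`). Locally `𝒥` is generated by `q` odd coordinates, so
`𝒥^(q+1) = 0` (`pow_eq_bot_of_exterior`). The factors `1, …, q` therefore kill `𝒥`, the factors `2,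
…, q` kill `𝒥²`, and the scalars in front normalise the eigenvalue on `𝒪/𝒥`, respectively `𝒥/𝒥²`, to
`1`. This gives the first two claims.

For the splitting, the operators of `H₊` commute with `H₊`, so `O⁽¹⁾` takes values in the kernel of
`H₊` and `O⁽²⁾` maps `𝒥` to eigenvectors of eigenvalue `1`. On a stalk the kernel of the even
derivation is a subring which maps isomorphically onto `𝒪_{X,x}`, and the eigenvectors of eigenvalue
`1` in `𝒥` form a module over it, isomorphic to `𝒥/𝒥²`. The former are even, hence central; the
latter are odd, hence square to zero. The universal property of the exterior algebra yields `Ψ :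
⋀(𝒥/𝒥²) → 𝒪_{𝔛,x}`; comparison with a map in the other direction, coming from a local
trivialization, shows that it is bijective (`exists_stalk_splitting`). The stalk maps are given by
operators on sections, so they glue to an isomorphism of sheaves. Uniqueness holds because functions
and odd classes locally generate the split model (`splitModel_endo_eq_self`). -/

lemma Ideal.mem_pow_zero (a : A) : a ∈ J ^ 0 := by
  rw [Submodule.pow_zero, Ideal.one_eq_top]; trivial

/-- Holds because `J ^ (m + 1) = J ^ m * J` is additively generated by products. The predicate
carries the exponent, so that it can express statements about `J ^ m / J ^ (m + 1)`. -/
lemma Ideal.pow_induction {P : ℕ → A → Prop} (h0 : ∀ a, P 0 a)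
    (hmul : ∀ m, ∀ a ∈ J ^ m, ∀ b ∈ J, P m a → P (m + 1) (a * b))
    (hadd : ∀ m a b, P m a → P m b → P m (a + b)) (m : ℕ) : ∀ a ∈ J ^ m, P m a := by
  induction m with
  | zero => exact fun a _ => h0 a
  | succ m ih =>
    intro a ha
    rw [Submodule.pow_succ] at ha
    induction ha using Submodule.mul_induction_on' with
    | mem_mul_mem a ha b hb => exact hmul m a ha b hb (ih a ha)
    | add a _ b _ h h' => exact hadd _ _ _ h h'

lemma Ideal.mul_mem_pow_add [J.IsTwoSided] {m n k : ℕ} (hk : m + n = k) {a b : A} (ha : a ∈ J ^ m)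
    (hb : b ∈ J ^ n) : a * b ∈ J ^ k := by
  rw [← hk, Ideal.IsTwoSided.pow_add]
  exact Ideal.mul_mem_mul ha hb

lemma map_mem_pow (σ : A →+* A) (hσ : ∀ a ∈ J, σ a ∈ J) (m : ℕ) :
    ∀ a ∈ J ^ m, σ a ∈ J ^ m := by
  refine Ideal.pow_induction (P := fun m a => σ a ∈ J ^ m) (fun a => Ideal.mem_pow_zero _)
    (fun m a _ b hb h => ?_) (fun m a b h h' => ?_) m
  · rw [map_mul, Submodule.pow_succ]
    exact Ideal.mul_mem_mul h (hσ b hb)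
  · rw [map_add]; exact add_mem h h'

/-- A derivation which acts by `0` on `A / J` and by `1` on `J / J²` acts by `m` on
`J ^ m / J ^ (m + 1)`. -/
lemma derivation_sub_mem_pow [J.IsTwoSided] (D : A →+ A) (hD : ∀ a b, D (a * b) = D a * b + a * D b)
    (h0 : ∀ a, D a ∈ J) (h1 : ∀ a ∈ J, D a - a ∈ J ^ 2) (m : ℕ) :
    ∀ a ∈ J ^ m, D a - m • a ∈ J ^ (m + 1) := by
  refine Ideal.pow_induction (P := fun m a => D a - m • a ∈ J ^ (m + 1))
    (fun a => ?_) (fun m a ha b hb h => ?_) (fun m a b h h' => ?_) m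
  · simpa [Submodule.pow_one] using h0 a
  · have h2 : D (a * b) - (m + 1) • (a * b) = (D a - m • a) * b + a * (D b - b) := by
      rw [hD]; simp only [nsmul_eq_mul, Nat.cast_add, Nat.cast_one]; noncomm_ring
    rw [h2]
    refine add_mem ?_ (Ideal.mul_mem_pow_add (by omega) ha (h1 b hb))
    exact Ideal.mul_mem_pow_add rfl h (by rwa [Submodule.pow_one])
  · have : D (a + b) - m • (a + b) = (D a - m • a) + (D b - m • b) := by
      rw [map_add, smul_add]; abel
    rw [this]; exact add_mem h h'

/-- A twisted derivation which raises the filtration degree by one on `A` and on `J` raises it by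
one on `J ^ m`. -/
lemma twistedDerivation_mem_pow [J.IsTwoSided] (σ : A →+* A) (hσ : ∀ a ∈ J, σ a ∈ J) (D : A →+ A)
    (hD : ∀ a b, D (a * b) = D a * b + σ a * D b)
    (h0 : ∀ a, D a ∈ J) (h1 : ∀ a ∈ J, D a ∈ J ^ 2) (m : ℕ) :
    ∀ a ∈ J ^ m, D a ∈ J ^ (m + 1) := by
  refine Ideal.pow_induction (P := fun m a => D a ∈ J ^ (m + 1))
    (fun a => ?_) (fun m a ha b hb h => ?_) (fun m a b h h' => ?_) m
  · simpa [Submodule.pow_one] using h0 a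
  · rw [hD]
    exact add_mem (Ideal.mul_mem_pow_add rfl h (by rwa [Submodule.pow_one]))
      (Ideal.mul_mem_pow_add (by omega) (map_mem_pow σ hσ m a ha) (h1 b hb))
  · rw [map_add]; exact add_mem h h'

/-- A ring endomorphism which is the identity modulo `J` and on `J / J²` is bijective if `J` is
nilpotent. -/
lemma bijective_of_sub_mem [J.IsTwoSided] {n : ℕ} (hJ : J ^ n = ⊥) (M : A →+* A)
    (h0 : ∀ a, M a - a ∈ J) (h1 : ∀ a ∈ J, M a - a ∈ J ^ 2) : Function.Bijective M := by
  have key : ∀ m, ∀ a ∈ J ^ m, M a - a ∈ J ^ (m + 1) := by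
    refine Ideal.pow_induction (P := fun m a => M a - a ∈ J ^ (m + 1))
      (fun a => ?_) (fun m a ha b hb h => ?_) (fun m a b h h' => ?_)
    · simpa [Submodule.pow_one] using h0 a
    · have h2 : M (a * b) - a * b = (M a - a) * M b + a * (M b - b) := by
        rw [map_mul]; noncomm_ring
      have hMb : M b ∈ J := by simpa using add_mem (h0 b) hb
      rw [h2]
      exact add_mem (Ideal.mul_mem_pow_add rfl h (by rwa [Submodule.pow_one]))
        (Ideal.mul_mem_pow_add (by omega) ha (h1 b hb))
    · have : M (a + b) - (a + b) = (M a - a) + (M b - b) := by rw [map_add]; abel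
      rw [this]; exact add_mem h h'
  constructor
  · rw [injective_iff_map_eq_zero]
    intro a ha
    have : ∀ m, a ∈ J ^ m := by
      intro m
      induction m with
      | zero => exact Ideal.mem_pow_zero a
      | succ m ih => simpa [ha] using key m a ih
    simpa [hJ] using this n
  · intro a
    have : ∀ m, ∃ b, M b - a ∈ J ^ m := by
      intro m
      induction m with
      | zero => exact ⟨a, Ideal.mem_pow_zero _⟩
      | succ m ih =>
        obtain ⟨b, hb⟩ := ih
        -- Successive approximation: subtracting the error `M b - a` from `b` leaves, up to sign, `M
        -- - 1` applied to that error, which lies one step deeper.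
        refine ⟨b - (M b - a), ?_⟩
        have h2 : M (b - (M b - a)) - a = -(M (M b - a) - (M b - a)) := by
          rw [map_sub]; abel
        rw [h2]; exact neg_mem (key m _ hb)
    obtain ⟨b, hb⟩ := this n
    exact ⟨b, by rw [hJ, Ideal.mem_bot, sub_eq_zero] at hb; exact hb⟩

/-- If `a ∈ J ^ m` with `m > k`, its class modulo `J ^ (m + 1)` has both eigenvalues `m` and `k`.
Since `m - k` is invertible, `a` lies in `J ^ (m + 1)`; nilpotence ends the ascent. -/
lemma eq_zero_of_filtered [J.IsTwoSided] {n : ℕ} (hJ : J ^ n = ⊥)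
    (hunit : ∀ n : ℕ, n ≠ 0 → IsUnit (n : A)) (D : A → A)
    (hD : ∀ m, ∀ a ∈ J ^ m, D a - m • a ∈ J ^ (m + 1)) {k l : ℕ} (hkl : k < l) {a : A}
    (ha : a ∈ J ^ l) (hDa : D a = k • a) : a = 0 := by
  have : ∀ m, l ≤ m → a ∈ J ^ m := by
    intro m hm
    induction m, hm using Nat.le_induction with
    | base => exact ha
    | succ m hm ih =>
      have h1 := hD m a ih
      obtain ⟨d, rfl⟩ : ∃ d, m = k + (d + 1) := ⟨m - k - 1, by omega⟩
      rw [hDa, add_smul k (d + 1) a, sub_add_cancel_left, neg_mem_iff, nsmul_eq_mul] at h1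
      obtain ⟨v, hv⟩ := hunit (d + 1) d.succ_ne_zero
      rw [← hv] at h1
      simpa using Ideal.mul_mem_left _ (↑v⁻¹ : A) h1
  have h := Ideal.pow_le_pow_right (le_max_right l n) (this (max l n) (le_max_left _ _))
  simpa [hJ] using h

end Filtered

/-! ### Polynomials in an operator with eigenvalue `m` on the `m`-th graded piece -/

section FilteredModule

variable {E : Type*} [AddCommGroup E] [Module ℂ E] (F : ℕ → Submodule ℂ E) (hF : Antitone F)
  (T : E →ₗ[ℂ] E) (hT : ∀ m, ∀ f ∈ F m, T f - (m : ℂ) • f ∈ F (m + 1))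

include hF hT in
lemma filtered_mem {m : ℕ} {f : E} (hf : f ∈ F m) : T f ∈ F m := by
  simpa using add_mem (hF m.le_succ (hT m f hf)) ((F m).smul_mem (m : ℂ) hf)

include hF hT in
lemma aeval_mem (P : Polynomial ℂ) {m : ℕ} {f : E} (hf : f ∈ F m) :
    Polynomial.aeval (R := ℂ) (A := Module.End ℂ E) T P f ∈ F m := by
  induction P using Polynomial.induction_on' with
  | add p q hp hq => rw [map_add]; exact add_mem hp hq
  | monomial n c =>
    rw [Polynomial.aeval_monomial, ← Algebra.smul_def]
    refine (F m).smul_mem c ?_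
    induction n with
    | zero => simpa using hf
    | succ n ih => rw [pow_succ']; exact filtered_mem F hF T hT ih

include hF hT in
/-- `P(T)` acts by `P(m)` on `F m / F (m + 1)` if `T` acts by `m`. -/
lemma aeval_sub_mem (P : Polynomial ℂ) {m : ℕ} {f : E} (hf : f ∈ F m) :
    Polynomial.aeval (R := ℂ) (A := Module.End ℂ E) T P f - P.eval (m : ℂ) • f ∈ F (m + 1) := by
  -- With `P - P(m) = (X - m) Q`, the difference is `Q(T)` applied to `T f - m f`. That element is
  -- already in `F (m + 1)`, and `Q(T)` preserves the filtration.
  obtain ⟨Q, hQ⟩ := Polynomial.X_sub_C_dvd_sub_C_eval (p := P) (a := (m : ℂ))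
  have h : Polynomial.aeval (R := ℂ) (A := Module.End ℂ E) T P f - P.eval (m : ℂ) • f =
      Polynomial.aeval (R := ℂ) (A := Module.End ℂ E) T Q (T f - (m : ℂ) • f) := by
    have h' := congrArg (fun R => Polynomial.aeval (R := ℂ) (A := Module.End ℂ E) T R f) hQ
    rw [mul_comm] at h'
    simpa [Module.algebraMap_end_apply, Nat.cast_smul_eq_nsmul] using h'
  rw [h]
  exact aeval_mem F hF T hT Q (hT m f hf)

-- The factor `j - T` annihilates the `j`-th graded piece, so the factors from `m` to `n - 1`,
-- applied in increasing order, climb from `F m` to `F n`. For `n ≤ m` the product is empty and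
-- antitonicity suffices.
include hF hT in
lemma aeval_prod_mem (m n : ℕ) {f : E} (hf : f ∈ F m) :
    Polynomial.aeval (R := ℂ) (A := Module.End ℂ E) T
      (∏ j ∈ Finset.Ico m n, (Polynomial.C (j : ℂ) - Polynomial.X)) f ∈ F n := by
  rcases le_total m n with h | h
  · induction n, h using Nat.le_induction with
    | base => simpa using hf
    | succ n hn ih =>
      rw [Finset.prod_Ico_succ_top hn, mul_comm, map_mul, Module.End.mul_apply]
      rw [← neg_mem_iff]
      simpa [Module.algebraMap_end_apply, Nat.cast_smul_eq_nsmul] using hT n _ ih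
  · simpa [Finset.Ico_eq_empty_of_le h] using hF h hf

end FilteredModule

/-! ### Normalisation of the splitting polynomials -/

lemma prod_Icc_id (n : ℕ) : ∏ j ∈ Finset.Icc 1 n, j = n.factorial := by
  induction n with
  | zero => rfl
  | succ n ih => rw [Finset.prod_Icc_succ_top (by omega), ih, Nat.factorial_succ, mul_comm]

open Superspace in
lemma splitPoly₁_eval (q : ℕ) : (splitPoly₁ q).eval ((0 : ℕ) : ℂ) = 1 := by
  have h : (q.factorial : ℂ) ≠ 0 := by exact_mod_cast q.factorial_ne_zero
  simp only [splitPoly₁, Polynomial.eval_mul, Polynomial.eval_C, Polynomial.eval_prod,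
    Polynomial.eval_sub, Polynomial.eval_X, Nat.cast_zero, sub_zero]
  rw [← Nat.cast_prod, prod_Icc_id, inv_mul_cancel₀ h]

open Superspace in
lemma splitPoly₂_eval (q : ℕ) : (splitPoly₂ q).eval ((1 : ℕ) : ℂ) = 1 := by
  have h : ((q - 1).factorial : ℂ) ≠ 0 := by exact_mod_cast (q - 1).factorial_ne_zero
  simp only [splitPoly₂, Polynomial.eval_mul, Polynomial.eval_C, Polynomial.eval_prod,
    Polynomial.eval_sub, Polynomial.eval_X]
  -- The shift `j ↦ j + 1` identifies `1, …, q - 1` with `2, …, q`. With truncated subtraction, both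
  -- products are empty for `q = 0` as well as for `q = 1`.
  have h2 : ∏ j ∈ Finset.Icc 2 q, ((j : ℂ) - (1 : ℕ)) = ((q - 1).factorial : ℂ) := by
    rw [← prod_Icc_id, Nat.cast_prod]
    refine (Finset.prod_bij (fun j _ => j + 1) (fun j hj => ?_) (fun _ _ _ _ h => by simpa using h)
      (fun j hj => ⟨j - 1, ?_, ?_⟩) (fun j hj => by simp)).symm
    · simp only [Finset.mem_Icc] at *; omega
    · simp only [Finset.mem_Icc] at *; omega
    · simp only [Finset.mem_Icc] at hj; omega
  rw [h2, inv_mul_cancel₀ h]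

/-! ### Ring homomorphisms out of an exterior algebra -/

section ExteriorMaps

variable {R M A : Type*} [CommRing R] [AddCommGroup M] [Module R M] [Ring A]

/-- The universal property for a noncommutative target without a chosen algebra structure: the
central homomorphism `s` supplies one locally, and `t` becomes linear for it. -/
lemma exists_exteriorLift (s : R →+* A) (hs : ∀ r a, s r * a = a * s r) (t : M →+ A)
    (ht : ∀ r m, t (r • m) = s r * t m) (ht2 : ∀ m, t m * t m = 0) :
    ∃ Ψ : ExteriorAlgebra R M →+* A, (∀ r, Ψ (algebraMap R _ r) = s r) ∧
      ∀ m, Ψ (ExteriorAlgebra.ι R m) = t m := by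
  let _ : Algebra R A := s.toAlgebra' hs
  let t' : M →ₗ[R] A :=
    { toFun := t, map_add' := map_add t, map_smul' := fun r m => by
        rw [ht, RingHom.id_apply, Algebra.smul_def]; rfl }
  refine ⟨(ExteriorAlgebra.lift R ⟨t', ht2⟩ : ExteriorAlgebra R M →ₐ[R] A).toRingHom,
    fun r => ?_, fun m => ?_⟩
  · exact AlgHom.commutes _ r
  · exact ExteriorAlgebra.lift_ι_apply R t' ht2 m

lemma exterior_ringHom_ext {φ ψ : ExteriorAlgebra R M →+* A}
    (h : ∀ r, φ (algebraMap R _ r) = ψ (algebraMap R _ r))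
    (h' : ∀ m, φ (ExteriorAlgebra.ι R m) = ψ (ExteriorAlgebra.ι R m)) : φ = ψ := by
  ext a
  induction a using ExteriorAlgebra.induction with
  | algebraMap r => exact h r
  | ι m => exact h' m
  | mul a b ha hb => rw [map_mul, map_mul, ha, hb]
  | add a b ha hb => rw [map_add, map_add, ha, hb]

lemma exterior_ringHom_ext_pi {q : ℕ} {φ ψ : ExteriorAlgebra R (Fin q → R) →+* A}
    (h : ∀ r, φ (algebraMap R _ r) = ψ (algebraMap R _ r))
    (h' : ∀ i, φ (ExteriorAlgebra.ι R (Pi.single i 1)) = ψ (ExteriorAlgebra.ι R (Pi.single i 1))) :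
    φ = ψ := by
  refine exterior_ringHom_ext h fun m => ?_
  have : m = ∑ i, m i • (Pi.single i 1 : Fin q → R) := by
    rw [← Finset.univ_sum_single m]
    refine Finset.sum_congr rfl fun i _ => ?_
    rw [← Pi.single_smul]; simp
  rw [this]
  rw [map_sum, map_sum, map_sum]
  refine Finset.sum_congr rfl fun i _ => ?_
  rw [map_smul, Algebra.smul_def, map_mul, map_mul, h, h']

end ExteriorMaps

/-! ### Splitting a single stalk by an even derivation -/

section StalkAlgebra

variable {A R M : Type*} [Ring A] [CommRing R] [AddCommGroup M] [Module R M]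

lemma Ideal.mul_mem_sq {J : Ideal A} {a b : A} (ha : a ∈ J) (hb : b ∈ J) : a * b ∈ J ^ 2 := by
  rw [Submodule.pow_succ, Submodule.pow_one]
  exact Ideal.mul_mem_mul ha hb

/-- The kernel of an even derivation which acts by `m` on `J ^ m / J ^ (m + 1)` is a section of
the augmentation. -/
lemma exists_ringHom_section (aug : A →+* R) (D : A →+ A)
    (hD : ∀ a b, D (a * b) = D a * b + a * D b)
    (hinj : ∀ a, D a = 0 → aug a = 0 → a = 0) (hex : ∀ r, ∃ a, D a = 0 ∧ aug a = r) :
    ∃ s : R →+* A, ∀ a, D a = 0 → s (aug a) = a := by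
  have hD1 : D 1 = 0 := by simpa using hD 1 1
  -- By the Leibniz rule the kernel of `D` is a subring. The augmentation restricts to a bijection
  -- from it onto `R`, whose inverse is the section.
  let K : Subring A :=
    { carrier := {a | D a = 0}
      mul_mem' := fun {a b} (ha : D a = 0) (hb : D b = 0) =>
        show D (a * b) = 0 by rw [hD, ha, hb]; simp
      one_mem' := hD1
      add_mem' := fun {a b} (ha : D a = 0) (hb : D b = 0) =>
        show D (a + b) = 0 by rw [map_add, ha, hb, add_zero]
      zero_mem' := map_zero D
      neg_mem' := fun {a} (ha : D a = 0) => show D (-a) = 0 by rw [map_neg, ha, neg_zero] }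
  have hbij : Function.Bijective (aug.comp K.subtype) := by
    constructor
    · rw [injective_iff_map_eq_zero]
      exact fun a ha => Subtype.ext (hinj a.1 a.2 ha)
    · intro r
      obtain ⟨a, ha, rfl⟩ := hex r
      exact ⟨⟨a, ha⟩, rfl⟩
  let e := RingEquiv.ofBijective _ hbij
  refine ⟨K.subtype.comp e.symm.toRingHom, fun a ha => ?_⟩
  exact congrArg Subtype.val (e.symm_apply_apply ⟨a, ha⟩)

/-- The eigenvectors of eigenvalue `1` in `J` form a subgroup which `cls` maps bijectively onto `M`;
`t` is the inverse. This is the odd counterpart of the section on functions. -/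
lemma exists_addMonoidHom_section {J : Ideal A} (cls : J →+ M) (D : A →+ A)
    (hinj : ∀ v : J, D v = v → cls v = 0 → v = 0)
    (hex : ∀ m, ∃ v : J, D v = v ∧ cls v = m) :
    ∃ t : M →+ A, ∀ v : J, D v = v → t (cls v) = v := by
  let K : AddSubgroup J :=
    { carrier := {v | D v = v}
      add_mem' := fun {a b} (ha : D a = a) (hb : D b = b) =>
        show D (a + b) = a + b by rw [map_add, ha, hb]
      zero_mem' := map_zero D
      neg_mem' := fun {a} (ha : D a = a) => show D (-a) = -a by rw [map_neg, ha] }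
  have hbij : Function.Bijective (cls.comp K.subtype) := by
    constructor
    · rw [injective_iff_map_eq_zero]
      exact fun a ha => Subtype.ext (hinj a.1 a.2 ha)
    · intro r
      obtain ⟨a, ha, rfl⟩ := hex r
      exact ⟨⟨a, ha⟩, rfl⟩
  let e := AddEquiv.ofBijective _ hbij
  refine ⟨(J.subtype.toAddMonoidHom.comp K.subtype).comp e.symm.toAddMonoidHom, fun v hv => ?_⟩
  exact congrArg (fun v : K => (v.1 : A)) (e.symm_apply_apply ⟨v, hv⟩)

lemma algebraMapInv_ι (m : M) :
    ExteriorAlgebra.algebraMapInv (R := R) (ExteriorAlgebra.ι R m) = 0 := by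
  simp [ExteriorAlgebra.algebraMapInv]

/-- The involution is `+1` on the even part and `-1` on the odd part, so the component of the wrong
parity equals its own negative and vanishes once `2` is invertible. This turns parity into an
equation that ring homomorphisms can transport. -/
lemma mem_evenOdd_of_involute {e : ExteriorAlgebra R M} (h2 : IsUnit (2 : R)) (i : ZMod 2)
    (he : CliffordAlgebra.involute e = (-1) ^ i.val * e) :
    e ∈ CliffordAlgebra.evenOdd (0 : QuadraticForm R M) i := by
  obtain ⟨a, ha, b, hb, rfl⟩ := Submodule.mem_sup.1
    ((CliffordAlgebra.evenOdd_isCompl (Q := (0 : QuadraticForm R M))).sup_eq_top ▸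
      (Submodule.mem_top : e ∈ _))
  have key : ∀ c : ExteriorAlgebra R M, c + c = 0 → c = 0 := by
    intro c hc
    obtain ⟨u, hu⟩ := h2
    have h : (2 : R) • c = 0 := by rw [two_smul, hc]
    rw [← hu] at h
    have h' := congrArg (fun d => (↑u⁻¹ : R) • d) h
    simpa [smul_smul] using h'
  rw [map_add, CliffordAlgebra.involute_eq_of_mem_even ha,
    CliffordAlgebra.involute_eq_of_mem_odd hb] at he
  obtain rfl | rfl := zmod2 i
  · have : b = 0 := key b (by
      simp only [ZMod.val_zero, pow_zero, one_mul] at he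
      have h3 := sub_eq_zero.2 he
      have h4 : a + -b - (a + b) = -(b + b) := by abel
      rw [h4] at h3
      exact neg_eq_zero.1 h3)
    rwa [this, add_zero]
  · have : a = 0 := key a (by
      simp only [ZMod.val_one, pow_one, neg_mul, one_mul] at he
      have h3 := sub_eq_zero.2 he
      have h4 : a + -b - -(a + b) = a + a := by abel
      rwa [h4] at h3)
    rwa [this, zero_add]

/-- The even derivation `D` of the stalk `A`, which acts by `m` on `J ^ m / J ^ (m + 1)`, defines
an isomorphism of `⋀ (J / J²)` with `A`. -/
theorem exists_stalk_splitting (aug : A →+* R) {J : Ideal A} [J.IsTwoSided]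
    (hJ : ∀ a, a ∈ J ↔ aug a = 0) {n : ℕ} (hn : J ^ n = ⊥)
    (hunit : ∀ n : ℕ, n ≠ 0 → IsUnit (n : A))
    (cls : J →+ M) (hcls : ∀ v, cls v = 0 ↔ (v : A) ∈ J ^ 2)
    (hsmul : ∀ a v, cls (a • v) = aug a • cls v)
    (D : A →+ A) (hD : ∀ a b, D (a * b) = D a * b + a * D b)
    (h0 : ∀ a, D a ∈ J) (h1 : ∀ a ∈ J, D a - a ∈ J ^ 2)
    (hex0 : ∀ r, ∃ a, D a = 0 ∧ aug a = r) (hex1 : ∀ m, ∃ v : J, D v = v ∧ cls v = m)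
    (σ : A →+* A) (hσD : ∀ a, D (σ a) = σ (D a)) (hσJ : ∀ a, σ a - a ∈ J)
    (hcomm : ∀ a, σ a = a → ∀ b, a * b = b * a) (hsq : ∀ a, σ a = -a → a * a = 0)
    {κ : Type*} (θ : κ → A) (hθJ : ∀ i, θ i ∈ J) (hθ : J ≤ Ideal.span (Set.range θ))
    (hσθ : ∀ i, σ (θ i) = -θ i)
    (γ : A →+* ExteriorAlgebra R M) (hγ : Function.Surjective γ)
    (hγ0 : ∀ a, ExteriorAlgebra.algebraMapInv (γ a) = aug a)
    (hγ1 : ∀ i, γ (θ i) = ExteriorAlgebra.ι R (cls ⟨θ i, hθJ i⟩)) :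
    ∃ Ψ : ExteriorAlgebra R M →+* A, Function.Bijective Ψ ∧
      (∀ a, D a = 0 → Ψ (algebraMap R _ (aug a)) = a) ∧
      (∀ v : J, D v = v → Ψ (ExteriorAlgebra.ι R (cls v)) = v) ∧
      (∀ e, aug (Ψ e) = ExteriorAlgebra.algebraMapInv e) ∧
      ∀ e, σ (Ψ e) = Ψ (CliffordAlgebra.involute e) := by
  have hDm := derivation_sub_mem_pow D hD h0 h1
  have hinj0 : ∀ a, D a = 0 → a ∈ J → a = 0 := fun a ha ha' =>
    eq_zero_of_filtered hn hunit D hDm zero_lt_one (by rwa [Submodule.pow_one]) (by simpa using ha)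
  have hinj1 : ∀ a, D a = a → a ∈ J ^ 2 → a = 0 := fun a ha ha' =>
    eq_zero_of_filtered hn hunit D hDm one_lt_two ha' (by simpa using ha)
  have hspan : ∀ a ∈ Ideal.span (Set.range θ), a ∈ J := fun a ha =>
    Ideal.span_le.2 (Set.range_subset_iff.2 hθJ) ha
  -- The parity involution is `-1` on `J / J²`: this holds on the generators `θ i`, and `σ b ≡ b`
  -- modulo `J` takes care of coefficients.
  have hσ2 : ∀ a ∈ J, σ a + a ∈ J ^ 2 := by
    intro a ha
    have ha' := hθ ha
    clear ha
    induction ha' using Submodule.span_induction with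
    | mem x hx => obtain ⟨i, rfl⟩ := hx; rw [hσθ, neg_add_cancel]; exact zero_mem _
    | zero => simp
    | add x y _ _ hx hy =>
      have h : σ (x + y) + (x + y) = (σ x + x) + (σ y + y) := by rw [map_add]; abel
      rw [h]; exact add_mem hx hy
    | smul b x hx h =>
      have h' : σ (b • x) + b • x = σ b * (σ x + x) - (σ b - b) * x := by
        rw [smul_eq_mul, map_mul]; noncomm_ring
      rw [h']
      refine sub_mem (Ideal.mul_mem_left _ _ h) ?_
      exact Ideal.mul_mem_sq (hσJ b) (hspan x hx)
  obtain ⟨s, hs⟩ := exists_ringHom_section aug D hD (fun a ha ha' => hinj0 a ha ((hJ a).2 ha')) hex0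
  obtain ⟨t, ht⟩ := exists_addMonoidHom_section cls D
    (fun v hv hv' => Subtype.ext (hinj1 v hv ((hcls v).1 hv'))) hex1
  -- `σ` commutes with `D`, so `σ a - a` is again in the kernel of `D`; it lies in `J`, hence is
  -- zero. Thus `s` has even, and therefore central, values.
  have hs_fix : ∀ r, σ (s r) = s r := by
    intro r
    obtain ⟨a, ha, rfl⟩ := hex0 r
    rw [hs a ha, ← sub_eq_zero]
    exact hinj0 _ (by rw [map_sub, hσD, ha, map_zero, sub_zero]) (hσJ a)
  -- Likewise `σ v + v` has eigenvalue `1` and lies in `J²`, so it is zero. Thus `t` has odd values,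
  -- which square to zero.
  have ht_neg : ∀ m, σ (t m) = -t m := by
    intro m
    obtain ⟨v, hv, rfl⟩ := hex1 m
    rw [ht v hv, eq_neg_iff_add_eq_zero]
    exact hinj1 _ (by rw [map_add, hσD, hv]) (hσ2 v v.2)
  obtain ⟨Ψ, hΨ0, hΨ1⟩ := exists_exteriorLift s (fun r => hcomm _ (hs_fix r)) t
    (fun r m => by
      obtain ⟨a, ha, rfl⟩ := hex0 r
      obtain ⟨v, hv, rfl⟩ := hex1 m
      have h : D (a • v : J) = (a • v : J) := by
        change D (a * v) = a * v
        rw [hD, ha, hv, zero_mul, zero_add]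
      rw [← hsmul, hs a ha, ht v hv, ht _ h]; rfl)
    (fun m => hsq _ (ht_neg m))
  have hΨaug : ∀ e, aug (Ψ e) = ExteriorAlgebra.algebraMapInv e := by
    refine fun e => RingHom.congr_fun (f := aug.comp Ψ)
      (g := (ExteriorAlgebra.algebraMapInv : ExteriorAlgebra R M →ₐ[R] R).toRingHom)
      (exterior_ringHom_ext (fun r => ?_) fun m => ?_) e
    · obtain ⟨a, ha, rfl⟩ := hex0 r
      rw [RingHom.comp_apply, hΨ0, hs a ha]
      exact (ExteriorAlgebra.algebraMap_leftInverse _ _).symm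
    · obtain ⟨v, hv, rfl⟩ := hex1 m
      rw [RingHom.comp_apply, hΨ1, ht v hv, (hJ _).1 v.2]
      exact (algebraMapInv_ι (cls v)).symm
  refine ⟨Ψ, ?_, fun a ha => by rw [hΨ0, hs a ha], fun v hv => by rw [hΨ1, ht v hv], hΨaug, ?_⟩
  -- `Ψ ∘ γ` is the identity modulo `J` and on `J / J²`, hence bijective by nilpotence. Then `γ`,
  -- being surjective, is bijective, and so is `Ψ`. The map `γ` itself need not be compatible with
  -- `D`.
  · have hθ2 : ∀ i, Ψ (γ (θ i)) - θ i ∈ J ^ 2 := by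
      intro i
      obtain ⟨v, hv, hv'⟩ := hex1 (cls ⟨θ i, hθJ i⟩)
      rw [hγ1, ← hv', hΨ1, ht v hv]
      have := (hcls (v - ⟨θ i, hθJ i⟩)).1 (by rw [map_sub, hv', sub_self])
      exact this
    have hM0 : ∀ a, (Ψ.comp γ) a - a ∈ J := by
      intro a
      rw [hJ, map_sub, RingHom.comp_apply, hΨaug, hγ0, sub_self]
    have hMb : Function.Bijective (Ψ.comp γ) := by
      refine bijective_of_sub_mem hn (Ψ.comp γ) hM0 fun a ha => ?_
      have ha' := hθ ha
      clear ha
      induction ha' using Submodule.span_induction with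
      | mem x hx => obtain ⟨i, rfl⟩ := hx; exact hθ2 i
      | zero => simp
      | add x y _ _ hx hy =>
        have h : (Ψ.comp γ) (x + y) - (x + y) = ((Ψ.comp γ) x - x) + ((Ψ.comp γ) y - y) := by
          rw [map_add]; abel
        rw [h]; exact add_mem hx hy
      | smul b x hx h =>
        have h' : (Ψ.comp γ) (b • x) - b • x =
            ((Ψ.comp γ) b - b) * (Ψ.comp γ) x + b * ((Ψ.comp γ) x - x) := by
          rw [smul_eq_mul, map_mul]; noncomm_ring
        rw [h']
        refine add_mem ?_ (Ideal.mul_mem_left _ _ h)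
        exact Ideal.mul_mem_sq (hM0 b) (by simpa using add_mem (hM0 x) (hspan x hx))
    have hMb' : Function.Bijective (Ψ ∘ γ) := hMb
    have hγb : Function.Bijective γ := ⟨hMb'.1.of_comp, hγ⟩
    exact (Function.Bijective.of_comp_iff _ hγb).1 hMb'
  · refine fun e => RingHom.congr_fun (f := σ.comp Ψ)
      (g := Ψ.comp (CliffordAlgebra.involute (Q := (0 : QuadraticForm R M))).toRingHom)
      (exterior_ringHom_ext (fun r => ?_) fun m => ?_) e
    · have h : (CliffordAlgebra.involute (Q := (0 : QuadraticForm R M))) (algebraMap R _ r) =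
          algebraMap R _ r := AlgHom.commutes _ _
      change σ (Ψ _) = Ψ (CliffordAlgebra.involute (Q := (0 : QuadraticForm R M)) (algebraMap R _ r))
      rw [h]
      exact (congrArg σ (hΨ0 r)).trans ((hs_fix r).trans (hΨ0 r).symm)
    · have h : (CliffordAlgebra.involute (Q := (0 : QuadraticForm R M))) (ExteriorAlgebra.ι R m) =
          -ExteriorAlgebra.ι R m := CliffordAlgebra.involute_ι _
      change σ (Ψ _) = Ψ (CliffordAlgebra.involute (Q := (0 : QuadraticForm R M))
        (ExteriorAlgebra.ι R m))
      rw [h, map_neg, hΨ1, ht_neg]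

end StalkAlgebra

noncomputable section

namespace Superspace

variable {X : ComplexSpace.{u}} {𝔛 : Superspace X}

/-! ### Sections and germs -/

lemma res_res {U V W : Opens X.top} (h : V ≤ U) (h' : W ≤ V) (f : 𝔛.sec U) :
    𝔛.res h' (𝔛.res h f) = 𝔛.res (h'.trans h) f := by
  simp only [res, ← RingHom.comp_apply, ← RingCat.hom_comp, ← Functor.map_comp]
  rfl

lemma exists_res_eq {U V : Opens X.top} {x : X.top} (hU : x ∈ U) (hV : x ∈ V) {f : 𝔛.sec U}
    {g : 𝔛.sec V} (h : 𝔛.germ x hU f = 𝔛.germ x hV g) :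
    ∃ (W : Opens X.top) (_ : x ∈ W) (hWU : W ≤ U) (hWV : W ≤ V), 𝔛.res hWU f = 𝔛.res hWV g := by
  obtain ⟨W, hW, i, j, hij⟩ := TopCat.Presheaf.germ_eq 𝔛.sheaf.presheaf x hU hV f g h
  exact ⟨W, hW, leOfHom i, leOfHom j, hij⟩

lemma sec_ext {U : Opens X.top} {f g : 𝔛.sec U}
    (h : ∀ x (hx : x ∈ U), 𝔛.germ x hx f = 𝔛.germ x hx g) : f = g :=
  TopCat.Presheaf.section_ext 𝔛.sheaf U f g h

lemma exists_germ_le {V : Opens X.top} {x : X.top} (hV : x ∈ V) (a : 𝔛.stalk x) :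
    ∃ (W : Opens X.top) (_ : W ≤ V) (hx : x ∈ W) (f : 𝔛.sec W), 𝔛.germ x hx f = a := by
  obtain ⟨U, hU, f, rfl⟩ := exists_germ x a
  exact ⟨U ⊓ V, inf_le_right, ⟨hU, hV⟩, 𝔛.res inf_le_left f, germ_res _ _ _ _⟩

lemma exists_germ₂ (x : X.top) (a b : 𝔛.stalk x) :
    ∃ (U : Opens X.top) (hx : x ∈ U) (f g : 𝔛.sec U), 𝔛.germ x hx f = a ∧ 𝔛.germ x hx g = b := by
  obtain ⟨U, hU, f, rfl⟩ := exists_germ x a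
  obtain ⟨W, hW, hx, g, rfl⟩ := exists_germ_le hU b
  exact ⟨W, hx, 𝔛.res hW f, g, germ_res _ _ _ _, rfl⟩

/-- A family of additive maps which commutes with restriction acts on the stalks. -/
lemma exists_stalkMap (T : ∀ U, 𝔛.sec U →+ 𝔛.sec U)
    (hT : ∀ U V (h : V ≤ U) f, T V (𝔛.res h f) = 𝔛.res h (T U f)) (x : X.top) :
    ∃ t : 𝔛.stalk x →+ 𝔛.stalk x,
      ∀ U (hx : x ∈ U) (f : 𝔛.sec U), t (𝔛.germ x hx f) = 𝔛.germ x hx (T U f) := by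
  -- Equal germs come from sections that agree on a smaller neighbourhood, and the operators commute
  -- with restriction to it.
  have hwd : ∀ U V (hU : x ∈ U) (hV : x ∈ V) (f : 𝔛.sec U) (g : 𝔛.sec V),
      𝔛.germ x hU f = 𝔛.germ x hV g → 𝔛.germ x hU (T U f) = 𝔛.germ x hV (T V g) := by
    intro U V hU hV f g h
    obtain ⟨W, hW, hWU, hWV, h'⟩ := exists_res_eq hU hV h
    rw [← germ_res hWU x hW, ← germ_res hWV x hW, ← hT, ← hT, h']
  choose U hU f hf using exists_germ (𝔛 := 𝔛) x
  have key : ∀ V (hV : x ∈ V) (g : 𝔛.sec V),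
      𝔛.germ x (hU (𝔛.germ x hV g)) (T _ (f (𝔛.germ x hV g))) = 𝔛.germ x hV (T V g) :=
    fun V hV g => hwd _ _ _ _ _ _ (hf _)
  refine ⟨{ toFun := fun a => 𝔛.germ x (hU a) (T _ (f a)), map_zero' := ?_, map_add' := ?_ }, key⟩
  · have := key ⊤ trivial 0
    rwa [map_zero, map_zero, map_zero] at this
  · intro a b
    obtain ⟨V, hV, g, k, rfl, rfl⟩ := exists_germ₂ x a b
    rw [← map_add, key, key, key, map_add, map_add]

/-- A compatible family of ring homomorphisms on the sections near `x` factors through the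
stalk. -/
lemma exists_stalkDesc {B : Type u} [Ring B] (x : X.top) (φ : ∀ U, x ∈ U → 𝔛.sec U →+* B)
    (hφ : ∀ U V (hU : x ∈ U) (hV : x ∈ V) (h : V ≤ U) f, φ V hV (𝔛.res h f) = φ U hU f) :
    ∃ γ : 𝔛.stalk x →+* B, ∀ U (hU : x ∈ U) f, γ (𝔛.germ x hU f) = φ U hU f := by
  let c : Limits.Cocone ((OpenNhds.inclusion x).op ⋙ 𝔛.sheaf.presheaf) :=
    { pt := RingCat.of B
      ι :=
        { app := fun V => RingCat.ofHom (φ V.unop.1 V.unop.2)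
          naturality := by
            intro V W i
            ext f
            exact hφ _ _ V.unop.2 W.unop.2 (leOfHom ((OpenNhds.inclusion x).map i.unop)) f } }
  refine ⟨RingCat.Hom.hom (Limits.colimit.desc _ c), fun U hU f => ?_⟩
  exact congrArg (fun k => RingCat.Hom.hom k f) (Limits.colimit.ι_desc c (op ⟨U, hU⟩))

/-! ### The parity involution -/

lemma exists_parts {U : Opens X.top} (f : 𝔛.sec U) :
    ∃ a ∈ 𝔛.part U 0, ∃ b ∈ 𝔛.part U 1, a + b = f := by
  have hf : f ∈ 𝔛.part U 0 ⊔ 𝔛.part U 1 := by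
    rw [(𝔛.isCompl U).sup_eq_top]; trivial
  exact AddSubgroup.mem_sup.1 hf

lemma parts_unique {U : Opens X.top} {a a' b b' : 𝔛.sec U} (ha : a ∈ 𝔛.part U 0)
    (ha' : a' ∈ 𝔛.part U 0) (hb : b ∈ 𝔛.part U 1) (hb' : b' ∈ 𝔛.part U 1)
    (h : a + b = a' + b') : a = a' ∧ b = b' := by
  have h1 : a - a' = b' - b := by rw [sub_eq_sub_iff_add_eq_add, h, add_comm]
  have h2 : a - a' = 0 := by
    have := (𝔛.isCompl U).disjoint
    rw [AddSubgroup.disjoint_def] at this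
    exact this (sub_mem ha ha') (h1 ▸ sub_mem hb' hb)
  have h3 := sub_eq_zero.1 h2
  refine ⟨h3, ?_⟩
  rw [h3] at h
  exact add_left_cancel h

lemma one_mem_part (U : Opens X.top) : (1 : 𝔛.sec U) ∈ 𝔛.part U 0 := by
  rw [← map_one (𝔛.const U)]
  exact const_mem U 1

/-- Multiplicativity is the `ℤ/2`-grading: in a product the even-even and odd-odd terms are even and
the mixed terms are odd. Recording parity as a ring homomorphism makes it pass to stalks. -/
lemma exists_par (U : Opens X.top) : ∃ σ : 𝔛.sec U →+* 𝔛.sec U,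
    ∀ a ∈ 𝔛.part U 0, ∀ b ∈ 𝔛.part U 1, σ (a + b) = a - b := by
  choose a ha b hb hab using exists_parts (𝔛 := 𝔛) (U := U)
  have key : ∀ c ∈ 𝔛.part U 0, ∀ d ∈ 𝔛.part U 1, a (c + d) - b (c + d) = c - d := by
    intro c hc d hd
    obtain ⟨h, h'⟩ := parts_unique (ha _) hc (hb _) hd (hab (c + d))
    rw [h, h']
  refine ⟨{ toFun := fun f => a f - b f
            map_one' := ?_
            map_mul' := ?_
            map_zero' := ?_
            map_add' := ?_ }, key⟩
  · have := key 1 (one_mem_part U) 0 (zero_mem _)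
    rwa [add_zero, sub_zero] at this
  · intro f g
    have h1 := 𝔛.mul_mem U _ _ _ _ (ha f) (ha g)
    have h2 := 𝔛.mul_mem U _ _ _ _ (hb f) (hb g)
    have h3 := 𝔛.mul_mem U _ _ _ _ (ha f) (hb g)
    have h4 := 𝔛.mul_mem U _ _ _ _ (hb f) (ha g)
    have e : (1 : ZMod 2) + 1 = 0 := by decide
    rw [e] at h2
    rw [zero_add] at h1 h3
    rw [add_zero] at h4
    have h5 := key _ (add_mem h1 h2) _ (add_mem h3 h4)
    have h6 : a f * a g + b f * b g + (a f * b g + b f * a g) = f * g := by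
      conv_rhs => rw [← hab f, ← hab g]
      noncomm_ring
    rw [h6] at h5
    rw [h5]; noncomm_ring
  · have := key 0 (zero_mem _) 0 (zero_mem _)
    rwa [add_zero, sub_zero] at this
  · intro f g
    have h5 := key _ (add_mem (ha f) (ha g)) _ (add_mem (hb f) (hb g))
    have h6 : a f + a g + (b f + b g) = f + g := by
      conv_rhs => rw [← hab f, ← hab g]
      abel
    rw [h6] at h5
    rw [h5]; abel

/-- The parity involution of sections. -/
def par (U : Opens X.top) : 𝔛.sec U →+* 𝔛.sec U := (exists_par U).choose

lemma par_add {U : Opens X.top} {a b : 𝔛.sec U} (ha : a ∈ 𝔛.part U 0) (hb : b ∈ 𝔛.part U 1) :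
    par U (a + b) = a - b := (exists_par U).choose_spec a ha b hb

lemma par_even {U : Opens X.top} {a : 𝔛.sec U} (ha : a ∈ 𝔛.part U 0) : par U a = a := by
  simpa using par_add ha (zero_mem (𝔛.part U 1))

lemma par_odd {U : Opens X.top} {b : 𝔛.sec U} (hb : b ∈ 𝔛.part U 1) : par U b = -b := by
  simpa using par_add (zero_mem (𝔛.part U 0)) hb

lemma par_part {U : Opens X.top} {i : ZMod 2} {f : 𝔛.sec U} (hf : f ∈ 𝔛.part U i) :
    par U f = (-1) ^ i.val * f := by
  obtain rfl | rfl := zmod2 i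
  · simpa using par_even hf
  · simpa [ZMod.val_one] using par_odd hf

lemma par_res {U V : Opens X.top} (h : V ≤ U) (f : 𝔛.sec U) :
    par V (𝔛.res h f) = 𝔛.res h (par U f) := by
  obtain ⟨a, ha, b, hb, rfl⟩ := exists_parts f
  rw [par_add ha hb, map_add, map_sub]
  exact par_add (𝔛.res_mem _ _ h _ _ ha) (𝔛.res_mem _ _ h _ _ hb)

lemma aug_par {U : Opens X.top} (f : 𝔛.sec U) : 𝔛.aug U (par U f) = 𝔛.aug U f := by
  obtain ⟨a, ha, b, hb, rfl⟩ := exists_parts f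
  rw [par_add ha hb, map_add, map_sub, 𝔛.aug_odd U b hb, add_zero, sub_zero]

lemma even_commute {U : Opens X.top} {a : 𝔛.sec U} (ha : a ∈ 𝔛.part U 0) (f : 𝔛.sec U) :
    a * f = f * a := by
  obtain ⟨c, hc, d, hd, rfl⟩ := exists_parts f
  have h0 := 𝔛.supercomm U 0 0 _ _ ha hc
  have h1 := 𝔛.supercomm U 0 1 _ _ ha hd
  simp at h0 h1
  rw [mul_add, add_mul, h0, h1]

/-- Supercommutativity without a homogeneity assumption on `f`: the sign is absorbed into `par`. -/
lemma odd_mul {U : Opens X.top} {b : 𝔛.sec U} (hb : b ∈ 𝔛.part U 1) (f : 𝔛.sec U) :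
    b * f = par U f * b := by
  obtain ⟨c, hc, d, hd, rfl⟩ := exists_parts f
  have h1 := 𝔛.supercomm U 1 1 _ _ hb hd
  simp [ZMod.val_one] at h1
  rw [par_add hc hd, mul_add, sub_mul, even_commute hc b, h1, sub_eq_add_neg]

lemma exists_stalkPar (x : X.top) : ∃ σ : 𝔛.stalk x →+* 𝔛.stalk x,
    ∀ U (hx : x ∈ U) (f : 𝔛.sec U), σ (𝔛.germ x hx f) = 𝔛.germ x hx (par U f) :=
  exists_stalkDesc x (fun U hU => (𝔛.germ x hU).comp (par U)) fun U V hU hV h f => by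
    change 𝔛.germ x hV (par V (𝔛.res h f)) = 𝔛.germ x hU (par U f)
    rw [par_res, germ_res]

/-- The parity involution of the stalks. -/
def stalkPar (x : X.top) : 𝔛.stalk x →+* 𝔛.stalk x := (exists_stalkPar x).choose

lemma stalkPar_germ {U : Opens X.top} (x : X.top) (hx : x ∈ U) (f : 𝔛.sec U) :
    stalkPar x (𝔛.germ x hx f) = 𝔛.germ x hx (par U f) := (exists_stalkPar x).choose_spec U hx f

lemma isUnit_natCast_stalk (x : X.top) (n : ℕ) (hn : n ≠ 0) : IsUnit (n : 𝔛.stalk x) := by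
  have h : IsUnit (n : ℂ) := (Nat.cast_ne_zero.2 hn).isUnit
  have := h.map ((𝔛.germ x (U := ⊤) trivial).comp (𝔛.const ⊤))
  rwa [map_natCast] at this

lemma eq_zero_of_add_self {x : X.top} {a : 𝔛.stalk x} (h : a + a = 0) : a = 0 := by
  have h2 := isUnit_natCast_stalk (𝔛 := 𝔛) x 2 two_ne_zero
  rw [← two_mul] at h
  exact (IsUnit.mul_right_eq_zero h2).1 (by exact_mod_cast h)

lemma mem_J_iff {x : X.top} (a : 𝔛.stalk x) : a ∈ 𝔛.J x ↔ 𝔛.stalkAug x a = 0 := RingHom.mem_ker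

lemma germ_mem_J_iff {U : Opens X.top} {x : X.top} (hx : x ∈ U) (f : 𝔛.sec U) :
    𝔛.germ x hx f ∈ 𝔛.J x ↔ X.germ x hx (𝔛.aug U f) = 0 := by rw [mem_J_iff, stalkAug_germ]

lemma forall_germ_mem_J_iff {U : Opens X.top} (f : 𝔛.sec U) :
    (∀ x (hx : x ∈ U), 𝔛.germ x hx f ∈ 𝔛.J x) ↔ 𝔛.aug U f = 0 := by
  simp only [germ_mem_J_iff]
  exact ⟨fun h => ComplexSpace.fn_ext _ _ fun x hx => by rw [h, map_zero], fun h => by simp [h]⟩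

lemma stalkPar_sub_mem (x : X.top) (a : 𝔛.stalk x) : stalkPar x a - a ∈ 𝔛.J x := by
  obtain ⟨U, hx, f, rfl⟩ := exists_germ x a
  rw [stalkPar_germ, ← map_sub, germ_mem_J_iff, map_sub, aug_par, sub_self, map_zero]

lemma stalkPar_mem (x : X.top) (a : 𝔛.stalk x) (ha : a ∈ 𝔛.J x) : stalkPar x a ∈ 𝔛.J x := by
  simpa using add_mem (stalkPar_sub_mem x a) ha

lemma stalkPar_stalkPar (x : X.top) (a : 𝔛.stalk x) : stalkPar x (stalkPar x a) = a := by
  obtain ⟨U, hx, f, rfl⟩ := exists_germ x a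
  rw [stalkPar_germ, stalkPar_germ]
  obtain ⟨c, hc, d, hd, rfl⟩ := exists_parts f
  rw [par_add hc hd, sub_eq_add_neg, par_add hc (neg_mem hd), sub_neg_eq_add]

/-- The odd part of a representative has a germ equal to its own negative, hence zero; the germ is
therefore that of an even section. -/
lemma commute_of_stalkPar_eq {x : X.top} {a : 𝔛.stalk x} (ha : stalkPar x a = a)
    (b : 𝔛.stalk x) : a * b = b * a := by
  obtain ⟨U, hx, f, g, rfl, rfl⟩ := exists_germ₂ x a b
  obtain ⟨c, hc, d, hd, rfl⟩ := exists_parts f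
  rw [stalkPar_germ, par_add hc hd, map_sub, map_add, ← sub_eq_zero] at ha
  have h : 𝔛.germ x hx d = 0 := neg_eq_zero.1 (eq_zero_of_add_self (by rw [← ha]; abel))
  rw [map_add, h, add_zero, ← map_mul, ← map_mul, even_commute hc]

/-- The germ is that of an odd section `d`, for which supercommutativity gives `d² = -d²`; `2` is
invertible on stalks. -/
lemma sq_eq_zero_of_stalkPar_eq {x : X.top} {a : 𝔛.stalk x} (ha : stalkPar x a = -a) :
    a * a = 0 := by
  obtain ⟨U, hx, f, rfl⟩ := exists_germ x a
  obtain ⟨c, hc, d, hd, rfl⟩ := exists_parts f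
  rw [stalkPar_germ, par_add hc hd, map_sub, map_add, ← sub_eq_zero] at ha
  have h : 𝔛.germ x hx c = 0 := eq_zero_of_add_self (by rw [← ha]; abel)
  rw [map_add, h, zero_add, ← map_mul]
  apply eq_zero_of_add_self
  have h1 := odd_mul hd d
  rw [par_odd hd, neg_mul] at h1
  have h2 : d * d + d * d = 0 := by nth_rewrite 1 [h1]; exact neg_add_cancel _
  rw [← map_add, h2, map_zero]

end Superspace

/-! ### Local trivializations -/

section ExteriorPi

variable {R A : Type*} [CommRing R] [Ring A] {q : ℕ}

lemma exterior_sub_aug_mem_span (z : ExteriorAlgebra R (Fin q → R)) :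
    z - algebraMap R _ (ExteriorAlgebra.algebraMapInv z) ∈
      Ideal.span (Set.range fun i : Fin q => ExteriorAlgebra.ι R (Pi.single i (1 : R))) := by
  induction z using ExteriorAlgebra.induction with
  | algebraMap r =>
    rw [ExteriorAlgebra.algebraMap_leftInverse _ r, sub_self]; exact zero_mem _
  | ι m =>
    rw [algebraMapInv_ι, map_zero, sub_zero]
    have : m = ∑ i, m i • (Pi.single i 1 : Fin q → R) := by
      rw [← Finset.univ_sum_single m]
      refine Finset.sum_congr rfl fun i _ => ?_
      rw [← Pi.single_smul]; simp
    rw [this, map_sum]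
    refine sum_mem fun i _ => ?_
    rw [map_smul, Algebra.smul_def]
    exact Ideal.mul_mem_left _ _ (Ideal.subset_span ⟨i, rfl⟩)
  | mul a b ha hb =>
    -- Scalars are central, so the error of a product can be written with the errors of `a` and `b`
    -- as right-hand factors, as membership in a left ideal requires.
    have h : a * b - algebraMap R _ (ExteriorAlgebra.algebraMapInv (a * b)) =
        a * (b - algebraMap R _ (ExteriorAlgebra.algebraMapInv b)) +
          algebraMap R _ (ExteriorAlgebra.algebraMapInv b) *
            (a - algebraMap R _ (ExteriorAlgebra.algebraMapInv a)) := by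
      rw [map_mul, mul_comm, map_mul, mul_sub, mul_sub, Algebra.commutes _ a]
      abel
    rw [h]
    exact add_mem (Ideal.mul_mem_left _ _ hb) (Ideal.mul_mem_left _ _ ha)
  | add a b ha hb =>
    have h : a + b - algebraMap R _ (ExteriorAlgebra.algebraMapInv (a + b)) =
        (a - algebraMap R _ (ExteriorAlgebra.algebraMapInv a)) +
          (b - algebraMap R _ (ExteriorAlgebra.algebraMapInv b)) := by
      rw [map_add, map_add]; abel
    rw [h]; exact add_mem ha hb

lemma map_mem_span_range {B : Type*} [Ring B] {κ : Type*} (τ : B →+* A) (g : κ → B) {z : B}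
    (hz : z ∈ Ideal.span (Set.range g)) : τ z ∈ Ideal.span (Set.range fun i => τ (g i)) := by
  induction hz using Submodule.span_induction with
  | mem x hx => obtain ⟨i, rfl⟩ := hx; exact Ideal.subset_span ⟨i, rfl⟩
  | zero => rw [map_zero]; exact zero_mem _
  | add x y _ _ hx hy => rw [map_add]; exact add_mem hx hy
  | smul b x _ hx => rw [smul_eq_mul, map_mul]; exact Ideal.mul_mem_left _ _ hx

/-- Coefficients move to the left past the `θ i` at the cost of `σ`, so `J ^ m` lies in the left
ideal generated by words of length `m` in the `θ i`. A word of length `q + 1` repeats one of the `q`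
letters and vanishes, being the image under `τ` of an alternating product. -/
lemma pow_eq_bot_of_exterior {J : Ideal A} (σ : A →+* A) (θ : Fin q → A)
    (hθ : ∀ i a, θ i * a = σ a * θ i) (hJ : J ≤ Ideal.span (Set.range θ))
    (τ : ExteriorAlgebra R (Fin q → R) →+* A)
    (hτ : ∀ i, τ (ExteriorAlgebra.ι R (Pi.single i 1)) = θ i) : J ^ (q + 1) = ⊥ := by
  have hcomm : ∀ (l : List (Fin q)) (a : A), ∃ b, (l.map θ).prod * a = b * (l.map θ).prod := by
    intro l
    induction l with
    | nil => exact fun a => ⟨a, by simp⟩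
    | cons i l ih =>
      intro a
      obtain ⟨b, hb⟩ := ih a
      exact ⟨σ b, by rw [List.map_cons, List.prod_cons, mul_assoc, hb, ← mul_assoc, hθ, mul_assoc]⟩
  have key : ∀ m, ∀ a ∈ J ^ m, a ∈ Ideal.span {p | ∃ l : List (Fin q), l.length = m ∧
      p = (l.map θ).prod} := by
    refine Ideal.pow_induction (P := fun m a => a ∈ Ideal.span {p | ∃ l : List (Fin q),
      l.length = m ∧ p = (l.map θ).prod}) (fun a => ?_) (fun m a ham b hb ha => ?_)
      (fun m a b ha hb => add_mem ha hb)
    · simp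
    · have hb' := hJ hb
      clear hb ham
      induction ha using Submodule.span_induction with
      | mem p hp =>
        obtain ⟨l, hl, rfl⟩ := hp
        induction hb' using Submodule.span_induction with
        | mem t ht =>
          obtain ⟨i, rfl⟩ := ht
          exact Ideal.subset_span ⟨l ++ [i], by simp [hl], by simp⟩
        | zero => rw [mul_zero]; exact zero_mem _
        | add x y _ _ hx hy => rw [mul_add]; exact add_mem hx hy
        | smul c x _ hx =>
          obtain ⟨d, hd⟩ := hcomm l c
          rw [smul_eq_mul, ← mul_assoc, hd, mul_assoc]
          exact Ideal.mul_mem_left _ _ hx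
      | zero => rw [zero_mul]; exact zero_mem _
      | add x y _ _ hx hy => rw [add_mul]; exact add_mem hx hy
      | smul c x _ hx => rw [smul_eq_mul, mul_assoc]; exact Ideal.mul_mem_left _ _ hx
  rw [eq_bot_iff]
  intro a ha
  refine (Ideal.span_le.2 ?_) (key _ a ha)
  rintro p ⟨l, hl, rfl⟩
  have h0 : ExteriorAlgebra.ιMulti R l.length
      (fun k => (Pi.single (l.get k) 1 : Fin q → R)) = 0 := by
    obtain ⟨a, b, hab, hne⟩ := Fintype.exists_ne_map_eq_of_card_lt l.get (by simp [hl])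
    exact AlternatingMap.map_eq_zero_of_eq _ _ (by simp only [hne]) hab
  have h1 := congrArg τ h0
  rw [ExteriorAlgebra.ιMulti_apply, map_zero, map_list_prod, List.map_ofFn] at h1
  have h2 : (τ ∘ fun k => ExteriorAlgebra.ι R (Pi.single (l.get k) 1 : Fin q → R)) =
      fun k => θ (l.get k) := funext fun k => hτ _
  rw [h2] at h1
  have h3 : l.map θ = List.ofFn fun k => θ (l.get k) := by
    conv_lhs => rw [← List.ofFn_get l, List.map_ofFn]
    rfl
  rw [SetLike.mem_coe, Ideal.mem_bot, h3, h1]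

end ExteriorPi

namespace Superspace

variable {X : ComplexSpace.{u}} {𝔛 : Superspace X} {q : ℕ} {V : Opens X.top}

lemma exists_fn_res_eq_zero {U : Opens X.top} {x : X.top} (hU : x ∈ U) {g : X.fn U}
    (h : X.germ x hU g = 0) : ∃ (W : Opens X.top) (_ : x ∈ W) (hWU : W ≤ U), X.res hWU g = 0 := by
  obtain ⟨W, hW, i, j, hij⟩ := TopCat.Presheaf.germ_eq X.toLRS.presheaf x hU hU g 0
    (by rw [map_zero]; exact h)
  refine ⟨W, hW, leOfHom i, ?_⟩
  rw [map_zero] at hij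
  exact hij

/-! ### Odd coordinates on the stalks -/

namespace LocalTrivialization

variable (T : 𝔛.LocalTrivialization q V)

/-- The germs of the odd coordinates. -/
def coord (x : X.top) (hx : x ∈ V) (i : Fin q) : 𝔛.stalk x :=
  𝔛.germ x hx (T.equiv V le_rfl (ExteriorAlgebra.ι _ (Pi.single i 1)))

lemma germ_gen {W : Opens X.top} (hW : W ≤ V) {x : X.top} (hx : x ∈ W) (i : Fin q) :
    𝔛.germ x hx (T.equiv W hW (ExteriorAlgebra.ι _ (Pi.single i 1))) = T.coord x (hW hx) i := by
  rw [coord, ← germ_res hW x hx]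
  congr 1
  exact (T.res_gen V W le_rfl hW i).symm

lemma gen_odd {W : Opens X.top} (hW : W ≤ V) (i : Fin q) :
    T.equiv W hW (ExteriorAlgebra.ι _ (Pi.single i 1)) ∈ 𝔛.part W 1 :=
  T.parity W hW 1 _ (CliffordAlgebra.ι_mem_evenOdd_one _ _)

lemma stalkPar_coord {x : X.top} (hx : x ∈ V) (i : Fin q) :
    stalkPar x (T.coord x hx i) = -T.coord x hx i := by
  rw [coord, stalkPar_germ, par_odd (T.gen_odd le_rfl i), map_neg]

lemma coord_mul {x : X.top} (hx : x ∈ V) (i : Fin q) (a : 𝔛.stalk x) :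
    T.coord x hx i * a = stalkPar x a * T.coord x hx i := by
  obtain ⟨W, hW, hxW, f, rfl⟩ := exists_germ_le hx a
  rw [stalkPar_germ, ← T.germ_gen hW hxW, ← map_mul, ← map_mul, odd_mul (T.gen_odd hW i)]

lemma coord_mem {x : X.top} (hx : x ∈ V) (i : Fin q) : T.coord x hx i ∈ 𝔛.J x := by
  rw [coord, germ_mem_J_iff, 𝔛.aug_odd _ _ (T.gen_odd le_rfl i), map_zero]

lemma exists_rep {x : X.top} (hx : x ∈ V) (a : 𝔛.stalk x) :
    ∃ (W : Opens X.top) (hW : W ≤ V) (hxW : x ∈ W)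
      (z : ExteriorAlgebra (X.fn W) (Fin q → X.fn W)), 𝔛.germ x hxW (T.equiv W hW z) = a := by
  obtain ⟨W, hW, hxW, f, rfl⟩ := exists_germ_le hx a
  exact ⟨W, hW, hxW, (T.equiv W hW).symm f, by rw [RingEquiv.apply_symm_apply]⟩

/-- A germ in `𝒥_x` has a representative whose augmentation vanishes on a whole neighbourhood. There
the trivialization turns it into an element of the augmentation ideal of the exterior algebra, which
the generators span. -/
lemma J_le {x : X.top} (hx : x ∈ V) : 𝔛.J x ≤ Ideal.span (Set.range (T.coord x hx)) := by
  intro a ha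
  obtain ⟨U, hU, hxU, f, rfl⟩ := exists_germ_le hx a
  rw [germ_mem_J_iff] at ha
  obtain ⟨W, hxW, hWU, h⟩ := exists_fn_res_eq_zero hxU ha
  rw [← germ_res hWU x hxW]
  obtain ⟨z, hz⟩ := (T.equiv W (hWU.trans hU)).surjective (𝔛.res hWU f)
  have hz0 : ExteriorAlgebra.algebraMapInv z = 0 := by
    rw [← T.aug W (hWU.trans hU), hz]
    exact (𝔛.aug_res _ _ hWU f).trans h
  have h1 := exterior_sub_aug_mem_span z
  rw [hz0, map_zero, sub_zero] at h1
  have h2 := map_mem_span_range ((𝔛.germ x hxW).comp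
    (T.equiv W (hWU.trans hU) : _ →+* 𝔛.sec W)) _ h1
  rw [← hz]
  refine (Ideal.span_le.2 ?_) h2
  rintro _ ⟨i, rfl⟩
  exact Ideal.subset_span ⟨i, (T.germ_gen (hWU.trans hU) hxW i).symm⟩

include T in
lemma J_pow_eq_bot {x : X.top} (hx : x ∈ V) : 𝔛.J x ^ (q + 1) = ⊥ :=
  pow_eq_bot_of_exterior (stalkPar x) (T.coord x hx) (T.coord_mul hx) (T.J_le hx)
    ((𝔛.germ x hx).comp
      (T.equiv V le_rfl : ExteriorAlgebra (X.fn V) (Fin q → X.fn V) →+* 𝔛.sec V)) fun _ => rfl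

include T in
lemma exists_aug_eq {W : Opens X.top} (hW : W ≤ V) (g : X.fn W) : ∃ f, 𝔛.aug W f = g :=
  ⟨T.equiv W hW (algebraMap _ _ g), by
    rw [T.aug]; exact ExteriorAlgebra.algebraMap_leftInverse _ _⟩

/-- The homomorphism from the stalk to `⋀ (𝒥_x / 𝒥_x²)` which sends the odd coordinates to their
classes. -/
lemma exists_toExt {x : X.top} (hx : x ∈ V) : ∃ γ : 𝔛.stalk x →+* 𝔛.Ext x,
    Function.Surjective γ ∧ (∀ a, ExteriorAlgebra.algebraMapInv (γ a) = 𝔛.stalkAug x a) ∧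
    ∀ i, γ (T.coord x hx i) = ExteriorAlgebra.ι _ (𝔛.cls x ⟨T.coord x hx i, T.coord_mem hx i⟩) := by
  -- On sections over `W` the map takes the germ of a function and sends the `i`-th basis vector to
  -- the class of the `i`-th coordinate; linearity over `𝒪_X(W)` goes through the germ map.
  have hδ : ∀ (W : Opens X.top) (hxW : x ∈ W),
      ∃ δ : ExteriorAlgebra (X.fn W) (Fin q → X.fn W) →+* 𝔛.Ext x,
        (∀ r, δ (algebraMap _ _ r) = algebraMap _ _ (X.germ x hxW r)) ∧
        ∀ i, δ (ExteriorAlgebra.ι _ (Pi.single i 1)) =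
          ExteriorAlgebra.ι _ (𝔛.cls x ⟨T.coord x hx i, T.coord_mem hx i⟩) := by
    intro W hxW
    let c : Fin q → 𝔛.OddCot x := fun i => 𝔛.cls x ⟨T.coord x hx i, T.coord_mem hx i⟩
    obtain ⟨δ, h, h'⟩ := exists_exteriorLift (M := Fin q → X.fn W)
      ((algebraMap (X.loc x) (𝔛.Ext x)).comp (X.germ x hxW)) (fun r a => Algebra.commutes (X.germ x hxW r) a)
      { toFun := fun m => ExteriorAlgebra.ι (X.loc x) (∑ i, X.germ x hxW (m i) • c i)
        map_zero' := by simp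
        map_add' := fun m m' => by
          simp only [Pi.add_apply, map_add, add_smul, Finset.sum_add_distrib] }
      (fun r m => by
        simp only [AddMonoidHom.coe_mk, ZeroHom.coe_mk, Pi.smul_apply, smul_eq_mul, map_mul,
          mul_smul, ← Finset.smul_sum, map_smul, RingHom.comp_apply]
        rw [Algebra.smul_def])
      (fun m => ExteriorAlgebra.ι_sq_zero _)
    refine ⟨δ, h, fun i => ?_⟩
    rw [h']
    change ExteriorAlgebra.ι (X.loc x) _ = ExteriorAlgebra.ι (X.loc x) (c i)
    congr 1
    rw [Finset.sum_eq_single i (fun j _ hj => by rw [Pi.single_eq_of_ne hj, map_zero, zero_smul])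
      (by simp), Pi.single_eq_same, map_one, one_smul]
  choose δ hδ0 hδ1 using hδ
  have hres : ∀ W W' (hxW : x ∈ W) (hxW' : x ∈ W') (hW : W ≤ V) (h : W' ≤ W) (f : 𝔛.sec W),
      δ W' hxW' ((T.equiv W' (h.trans hW)).symm (𝔛.res h f)) =
        δ W hxW ((T.equiv W hW).symm f) := by
    intro W W' hxW hxW' hW h f
    obtain ⟨z, rfl⟩ := (T.equiv W hW).surjective f
    rw [RingEquiv.symm_apply_apply]
    refine RingHom.congr_fun (f := (δ W' hxW').comp
      (((T.equiv W' (h.trans hW)).symm : 𝔛.sec W' →+* _).comp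
        ((𝔛.res h).comp (T.equiv W hW : _ →+* 𝔛.sec W)))) (g := δ W hxW)
      (exterior_ringHom_ext_pi (fun r => ?_) fun i => ?_) z
    · change δ W' hxW' ((T.equiv W' (h.trans hW)).symm (𝔛.res h (T.equiv W hW _))) = _
      rw [T.res_fn, RingEquiv.symm_apply_apply, hδ0, hδ0, X.germ_res]
    · change δ W' hxW' ((T.equiv W' (h.trans hW)).symm (𝔛.res h (T.equiv W hW _))) = _
      rw [T.res_gen, RingEquiv.symm_apply_apply, hδ1, hδ1]
  -- The trivialization only covers `V`, so sections over `U` are first restricted to `U ⊓ V`.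
  obtain ⟨γ, hγ⟩ := exists_stalkDesc (𝔛 := 𝔛) (B := 𝔛.Ext x) x
    (fun U hU => (δ (U ⊓ V) ⟨hU, hx⟩).comp
      (((T.equiv (U ⊓ V) inf_le_right).symm : 𝔛.sec (U ⊓ V) →+* _).comp (𝔛.res inf_le_left)))
    (fun U W hU hW h f => by
      have := hres (U ⊓ V) (W ⊓ V) ⟨hU, hx⟩ ⟨hW, hx⟩ inf_le_right (inf_le_inf_right V h)
        (𝔛.res inf_le_left f)
      rw [res_res] at this
      refine Eq.trans ?_ this
      change δ _ _ ((T.equiv (W ⊓ V) _).symm (𝔛.res _ (𝔛.res _ _))) = _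
      rw [res_res])
  have hγ' : ∀ W (hW : W ≤ V) (hxW : x ∈ W) z,
      γ (𝔛.germ x hxW (T.equiv W hW z)) = δ W hxW z := by
    intro W hW hxW z
    rw [hγ]
    refine (hres W (W ⊓ V) hxW ⟨hxW, hx⟩ hW inf_le_left _).trans ?_
    rw [RingEquiv.symm_apply_apply]
  have hγ1 : ∀ i, γ (T.coord x hx i) =
      ExteriorAlgebra.ι _ (𝔛.cls x ⟨T.coord x hx i, T.coord_mem hx i⟩) := fun i =>
    (hγ' V le_rfl hx _).trans (hδ1 V hx i)
  refine ⟨γ, fun e => ?_, fun a => ?_, hγ1⟩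
  -- Surjectivity: the range is a subring containing the functions and the classes of the
  -- coordinates. These classes span `𝒥_x / 𝒥_x²` over `𝒪_{X,x}`, so all generators of the exterior
  -- algebra are reached.
  · have hfn : ∀ r, algebraMap (X.loc x) (𝔛.Ext x) r ∈ γ.range := by
      intro r
      obtain ⟨a, rfl⟩ := 𝔛.stalkAug_surjective x r
      obtain ⟨W, hW, hxW, f, rfl⟩ := exists_germ_le hx a
      exact ⟨_, by rw [stalkAug_germ, hγ' W hW hxW (algebraMap _ _ (𝔛.aug W f)), hδ0]⟩
    have hspan : ∀ a ∈ Ideal.span (Set.range (T.coord x hx)), a ∈ 𝔛.J x := fun a ha =>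
      Ideal.span_le.2 (Set.range_subset_iff.2 (T.coord_mem hx)) ha
    have hodd : ∀ a ∈ Ideal.span (Set.range (T.coord x hx)), ∀ h : a ∈ 𝔛.J x,
        ExteriorAlgebra.ι (X.loc x) (𝔛.cls x ⟨a, h⟩) ∈ γ.range := by
      intro a ha
      induction ha using Submodule.span_induction with
      | mem v hv' => obtain ⟨i, rfl⟩ := hv'; exact fun _ => ⟨_, hγ1 i⟩
      | zero =>
        intro h
        have : (⟨0, h⟩ : 𝔛.J x) = 0 := rfl
        rw [this, map_zero, map_zero]; exact zero_mem _
      | add a b ha hb ha' hb' =>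
        intro h
        have : (⟨a + b, h⟩ : 𝔛.J x) = ⟨a, hspan a ha⟩ + ⟨b, hspan b hb⟩ := rfl
        rw [this, map_add, map_add]; exact add_mem (ha' _) (hb' _)
      | smul b a ha ha' =>
        intro h
        have : (⟨b • a, h⟩ : 𝔛.J x) = b • ⟨a, hspan a ha⟩ := rfl
        rw [this, map_smul, ← stalkAug_smul, map_smul, Algebra.smul_def]
        exact Subring.mul_mem _ (hfn _) (ha' _)
    change e ∈ γ.range
    induction e using ExteriorAlgebra.induction with
    | algebraMap r => exact hfn r
    | ι m =>
      obtain ⟨v, rfl⟩ := cls_surjective x m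
      exact hodd v (T.J_le hx v.2) v.2
    | mul a b ha hb => exact Subring.mul_mem _ ha hb
    | add a b ha hb => exact add_mem ha hb
  · obtain ⟨W, hW, hxW, z, rfl⟩ := T.exists_rep hx a
    rw [hγ', stalkAug_germ, T.aug]
    refine RingHom.congr_fun
      (f := (ExteriorAlgebra.algebraMapInv : 𝔛.Ext x →ₐ[X.loc x] X.loc x).toRingHom.comp (δ W hxW))
      (g := (X.germ x hxW).comp (ExteriorAlgebra.algebraMapInv :
        ExteriorAlgebra (X.fn W) (Fin q → X.fn W) →ₐ[X.fn W] X.fn W).toRingHom)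
      (exterior_ringHom_ext_pi (fun r => ?_) fun i => ?_) z
    · change ExteriorAlgebra.algebraMapInv (δ W hxW _) =
        X.germ x hxW (ExteriorAlgebra.algebraMapInv _)
      rw [hδ0, ExteriorAlgebra.algebraMap_leftInverse, ExteriorAlgebra.algebraMap_leftInverse]
    · change ExteriorAlgebra.algebraMapInv (δ W hxW _) =
        X.germ x hxW (ExteriorAlgebra.algebraMapInv _)
      rw [hδ1, algebraMapInv_ι, algebraMapInv_ι, map_zero]

end LocalTrivialization

end Superspace

namespace Superspace

variable {X : ComplexSpace.{u}} {𝔛 : Superspace X}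

/-! ### Vector fields with initial form `ε` -/

lemma exists_germ_of_mem_J {x : X.top} {a : 𝔛.stalk x} (ha : a ∈ 𝔛.J x) :
    ∃ (U : Opens X.top) (hx : x ∈ U) (f : 𝔛.sec U), 𝔛.aug U f = 0 ∧ 𝔛.germ x hx f = a := by
  obtain ⟨U, hU, f, rfl⟩ := exists_germ x a
  rw [germ_mem_J_iff] at ha
  obtain ⟨W, hW, hWU, h⟩ := exists_fn_res_eq_zero hU ha
  exact ⟨W, hW, 𝔛.res hWU f, (𝔛.aug_res _ _ hWU f).trans h, germ_res hWU x hW f⟩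

/-- Recovers usable information from the generated relation `symbol`. Degrees `0` and `1` are
enough, because the Leibniz rule determines the action on all higher graded pieces. -/
lemma symbol_zero {x : X.top} {p : 𝔛.stalk x × 𝔛.Ext x} (hp : p ∈ 𝔛.symbol x 0) :
    ExteriorAlgebra.algebraMapInv p.2 = 𝔛.stalkAug x p.1 := by
  induction hp using AddSubgroup.closure_induction with
  | mem p hp =>
    obtain ⟨c, v, rfl⟩ | ⟨h1, h2⟩ := hp
    · simp
    · rw [zero_add, Submodule.pow_one, mem_J_iff] at h1
      rw [h1, h2, map_zero]
  | zero => simp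
  | add p p' _ _ h h' => rw [Prod.fst_add, Prod.snd_add, map_add, map_add, h, h']
  | neg p _ h => rw [Prod.fst_neg, Prod.snd_neg, map_neg, map_neg, h]

lemma symbol_one {x : X.top} {p : 𝔛.stalk x × 𝔛.Ext x} (hp : p ∈ 𝔛.symbol x 1) :
    ∃ v : 𝔛.J x, (v : 𝔛.stalk x) = p.1 ∧ p.2 = ExteriorAlgebra.ι (X.loc x) (𝔛.cls x v) := by
  induction hp using AddSubgroup.closure_induction with
  | mem p hp =>
    obtain ⟨c, v, rfl⟩ | ⟨h1, h2⟩ := hp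
    · exact ⟨c • v 0, by simp, by
        rw [map_smul, ← stalkAug_smul, map_smul, ExteriorAlgebra.ιMulti_apply]
        simp⟩
    · refine ⟨⟨p.1, by simpa [Submodule.pow_one] using Ideal.pow_le_pow_right one_le_two h1⟩,
        rfl, ?_⟩
      rw [h2, (cls_eq_zero x _).2 h1, map_zero]
  | zero => exact ⟨0, rfl, by simp⟩
  | add p p' _ _ h h' =>
    obtain ⟨v, hv, hv'⟩ := h
    obtain ⟨w, hw, hw'⟩ := h'
    exact ⟨v + w, by simp [hv, hw], by simp [hv', hw']⟩
  | neg p _ h =>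
    obtain ⟨v, hv, hv'⟩ := h
    exact ⟨-v, by simp [hv], by simp [hv']⟩

lemma euler_act {U : Opens X.top} (s : 𝔛.splitModel.sec U) :
    𝔛.euler.act U s = 𝔛.eulerFun s := add_zero _

variable {H : 𝔛.VectorField}

namespace VectorField

/-- The initial form is tested in degree `0` on the pair of `f` and the function `α(f)`, which the
Euler field kills. The pair is a generator of the symbol with coefficient `f` and empty product. -/
lemma germ_act_mem (hH : H.HasInitialForm 𝔛.euler) {U : Opens X.top} (f : 𝔛.sec U) (x : X.top)
    (hx : x ∈ U) : 𝔛.germ x hx (H.act U f) ∈ 𝔛.J x := by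
  let s : 𝔛.splitModel.sec U := 𝔛.fnHom U (𝔛.aug U f)
  have h := hH.2 0 U f s (fun y hy => AddSubgroup.subset_closure (Or.inl
    ⟨𝔛.germ y hy f, Fin.elim0, Prod.ext (by simp) (by
      rw [stalkAug_germ, ExteriorAlgebra.ιMulti_zero_apply, ← Algebra.algebraMap_eq_smul_one]
      rfl)⟩)) x hx
  have h1 := symbol_zero h
  rw [euler_act, splitVal_eulerFun] at h1
  rw [mem_J_iff, ← h1]
  exact (congrArg _ (extDer_algebraMap _ _)).trans (map_zero _)

/-- The initial form is tested in degree `1` on `f` and its class, which the Euler field fixes.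
Injectivity of `ι` converts the equality in the exterior algebra into one in `𝒥_x / 𝒥_x²`. -/
lemma germ_act_sub_mem (hH : H.HasInitialForm 𝔛.euler) {U : Opens X.top} {f : 𝔛.sec U}
    (hf : 𝔛.aug U f = 0) (x : X.top) (hx : x ∈ U) :
    𝔛.germ x hx (H.act U f) - 𝔛.germ x hx f ∈ 𝔛.J x ^ 2 := by
  have hf' := (forall_germ_mem_J_iff f).2 hf
  let s : 𝔛.splitModel.sec U := (⟨ofOdd f hf', TopCat.PrelocalPredicate.sheafifyOf
    (Subring.subset_closure (Or.inr ⟨f, hf', rfl⟩))⟩ : 𝔛.splitSec U)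
  have h := hH.2 1 U f s (fun y hy => AddSubgroup.subset_closure (Or.inl
    ⟨1, fun _ => ⟨𝔛.germ y hy f, hf' y hy⟩, Prod.ext (by simp) (by
      rw [map_one, one_smul, ExteriorAlgebra.ιMulti_apply]
      simp
      rfl)⟩)) x hx
  obtain ⟨v, hv, hv'⟩ := symbol_one h
  rw [euler_act, splitVal_eulerFun] at hv'
  have h2 := (extDer_ι LinearMap.id (𝔛.cls x ⟨𝔛.germ x hx f, hf' x hx⟩)).symm.trans hv'
  have h3 := (ExteriorAlgebra.ι_inj (X.loc x) _ _).1 h2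
  have h4 := (cls_eq_zero x (v - ⟨𝔛.germ x hx f, hf' x hx⟩)).1 (by
    rw [map_sub, ← h3]; exact sub_self _)
  have h5 : (v : 𝔛.stalk x) = 𝔛.germ x hx (H.act U f) := hv
  rw [← h5]
  exact h4

/-- The actions of the even and the odd part on a stalk. -/
lemma exists_stalk_parts (hH : H.HasInitialForm 𝔛.euler) (x : X.top) :
    ∃ e o : 𝔛.stalk x →+ 𝔛.stalk x,
      (∀ U (hx : x ∈ U) f, e (𝔛.germ x hx f) = 𝔛.germ x hx (H.even.toFun U f)) ∧
      (∀ U (hx : x ∈ U) f, o (𝔛.germ x hx f) = 𝔛.germ x hx (H.odd.toFun U f)) ∧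
      (∀ a b, e (a * b) = e a * b + a * e b) ∧
      (∀ a b, o (a * b) = o a * b + stalkPar x a * o b) ∧
      (∀ a, e a ∈ 𝔛.J x) ∧ (∀ a ∈ 𝔛.J x, e a - a ∈ 𝔛.J x ^ 2) ∧
      (∀ a, o a ∈ 𝔛.J x) ∧ (∀ a ∈ 𝔛.J x, o a ∈ 𝔛.J x ^ 2) ∧
      (∀ a, e (stalkPar x a) = stalkPar x (e a)) := by
  obtain ⟨e, he⟩ := exists_stalkMap (fun U => (H.even.toFun U).toAddMonoidHom) H.even.res x
  obtain ⟨o, ho⟩ := exists_stalkMap (fun U => (H.odd.toFun U).toAddMonoidHom) H.odd.res x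
  replace he : ∀ U (hx : x ∈ U) f, e (𝔛.germ x hx f) = 𝔛.germ x hx (H.even.toFun U f) := he
  replace ho : ∀ U (hx : x ∈ U) f, o (𝔛.germ x hx f) = 𝔛.germ x hx (H.odd.toFun U f) := ho
  have hσe : ∀ a, e (stalkPar x a) = stalkPar x (e a) := by
    intro a
    obtain ⟨U, hx, f, rfl⟩ := exists_germ x a
    obtain ⟨c, hc, d, hd, rfl⟩ := exists_parts f
    have hc' := H.even.parity U 0 c hc
    have hd' := H.even.parity U 1 d hd
    rw [zero_add] at hc' hd'
    rw [stalkPar_germ, he, he, stalkPar_germ, par_add hc hd, map_sub, map_add, par_add hc' hd']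
  have hσo : ∀ a, o (stalkPar x a) = -stalkPar x (o a) := by
    intro a
    obtain ⟨U, hx, f, rfl⟩ := exists_germ x a
    obtain ⟨c, hc, d, hd, rfl⟩ := exists_parts f
    have hc' := H.odd.parity U 0 c hc
    have hd' := H.odd.parity U 1 d hd
    have e : (1 : ZMod 2) + 1 = 0 := by decide
    rw [e] at hd'
    rw [add_zero] at hc'
    rw [stalkPar_germ, ho, ho, stalkPar_germ, par_add hc hd, map_sub, map_add,
      add_comm (H.odd.toFun U c), par_add hd' hc', ← map_neg, neg_sub]
  have h0 : ∀ a, e a + o a ∈ 𝔛.J x := by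
    intro a
    obtain ⟨U, hx, f, rfl⟩ := exists_germ x a
    rw [he, ho, ← map_add]
    exact germ_act_mem hH f x hx
  have h1 : ∀ a ∈ 𝔛.J x, e a + o a - a ∈ 𝔛.J x ^ 2 := by
    intro a ha
    obtain ⟨U, hx, f, hf, rfl⟩ := exists_germ_of_mem_J ha
    rw [he, ho, ← map_add]
    exact germ_act_sub_mem hH hf x hx
  -- Sum and difference control both terms because `2` is invertible in the stalk.
  have hsplit : ∀ (m : ℕ) a b, a + b ∈ 𝔛.J x ^ m → a - b ∈ 𝔛.J x ^ m →
      a ∈ 𝔛.J x ^ m ∧ b ∈ 𝔛.J x ^ m := by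
    intro m a b h h'
    have hu := isUnit_natCast_stalk (𝔛 := 𝔛) x 2 two_ne_zero
    obtain ⟨v, hv⟩ := hu
    have h2 := Ideal.mul_mem_left _ (↑v⁻¹ : 𝔛.stalk x) (add_mem h h')
    have h3 : a + b + (a - b) = v * a := by rw [hv]; push_cast; noncomm_ring
    rw [h3, Units.inv_mul_cancel_left] at h2
    exact ⟨h2, by simpa using sub_mem h h2⟩
  -- Conjugation of `e + o` by the parity involution is `e - o`, since `e` commutes and `o`
  -- anticommutes with it. The involution preserves the powers of `𝒥`, so the estimates for `e + o`
  -- carry over.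
  have h0' : ∀ a, e a - o a ∈ 𝔛.J x := by
    intro a
    have h := stalkPar_mem x _ (h0 (stalkPar x a))
    rwa [hσe, hσo, ← map_neg, ← map_add, stalkPar_stalkPar, ← sub_eq_add_neg] at h
  have h1' : ∀ a ∈ 𝔛.J x, e a - a - o a ∈ 𝔛.J x ^ 2 := by
    intro a ha
    have h := map_mem_pow (stalkPar x) (stalkPar_mem x) 2 _ (h1 _ (stalkPar_mem x a ha))
    rw [hσe, hσo, ← map_neg, ← map_add, ← map_sub, stalkPar_stalkPar] at h
    convert h using 1
    abel
  refine ⟨e, o, he, ho, ?_, ?_, fun a => ?_, fun a ha => ?_, fun a => ?_, fun a ha => ?_, hσe⟩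
  · intro a b
    obtain ⟨U, hx, f, g, rfl, rfl⟩ := exists_germ₂ x a b
    obtain ⟨c, hc, d, hd, rfl⟩ := exists_parts f
    have h1 := H.even.leibniz U 0 c g hc
    have h2 := H.even.leibniz U 1 d g hd
    simp at h1 h2
    have h3 : H.even.toFun U ((c + d) * g) =
        H.even.toFun U (c + d) * g + (c + d) * H.even.toFun U g := by
      rw [add_mul, map_add, h1, h2, map_add, add_mul, add_mul]; abel
    rw [he, he, ← map_mul, he, h3, map_add, map_mul, map_mul]
  · intro a b
    obtain ⟨U, hx, f, g, rfl, rfl⟩ := exists_germ₂ x a b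
    obtain ⟨c, hc, d, hd, rfl⟩ := exists_parts f
    have h1 := H.odd.leibniz U 0 c g hc
    have h2 := H.odd.leibniz U 1 d g hd
    simp [ZMod.val_one] at h1 h2
    have h3 : H.odd.toFun U ((c + d) * g) =
        H.odd.toFun U (c + d) * g + (c - d) * H.odd.toFun U g := by
      rw [add_mul, map_add, h1, h2, map_add, add_mul, sub_mul]; abel
    rw [ho, ho, stalkPar_germ, ← map_mul, ho, h3, par_add hc hd, map_add, map_mul, map_mul]
  · have := hsplit 1 (e a) (o a)
    simp only [Submodule.pow_one] at this
    exact (this (h0 a) (h0' a)).1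
  · refine (hsplit 2 (e a - a) (o a) ?_ (h1' a ha)).1
    convert h1 a ha using 1
    abel
  · have := hsplit 1 (e a) (o a)
    simp only [Submodule.pow_one] at this
    exact (this (h0 a) (h0' a)).2
  · refine (hsplit 2 (e a - a) (o a) ?_ (h1' a ha)).2
    convert h1 a ha using 1
    abel

end VectorField

/-- The sections of `𝒥 ^ m` as a subspace. -/
def filt (U : Opens X.top) (m : ℕ) : Submodule ℂ (𝔛.sec U) where
  carrier := 𝔛.powJ m U
  zero_mem' := zero_mem _
  add_mem' := add_mem
  smul_mem' c f hf x hx := by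
    rw [Algebra.smul_def, map_mul]
    exact Ideal.mul_mem_left _ _ (hf x hx)

lemma mem_filt {U : Opens X.top} {m : ℕ} {f : 𝔛.sec U} :
    f ∈ filt U m ↔ ∀ x (hx : x ∈ U), 𝔛.germ x hx f ∈ 𝔛.J x ^ m := Iff.rfl

lemma mem_filt_zero {U : Opens X.top} (f : 𝔛.sec U) : f ∈ filt U 0 :=
  fun _ _ => Ideal.mem_pow_zero _

lemma mem_filt_one {U : Opens X.top} (f : 𝔛.sec U) : f ∈ filt U 1 ↔ 𝔛.aug U f = 0 := by
  rw [← forall_germ_mem_J_iff, mem_filt]; simp only [Submodule.pow_one]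

lemma filt_antitone (U : Opens X.top) : Antitone (filt (𝔛 := 𝔛) U) :=
  fun _ _ h _ hf x hx => Ideal.pow_le_pow_right h (hf x hx)

lemma filt_eq_bot {q : ℕ} (h𝔛 : 𝔛.IsSupermanifold q) {U : Opens X.top} {f : 𝔛.sec U}
    (hf : f ∈ filt U (q + 1)) : f = 0 := by
  refine sec_ext fun x hx => ?_
  obtain ⟨V, hxV, ⟨T⟩⟩ := h𝔛 x
  have := hf x hx
  rw [T.J_pow_eq_bot hxV] at this
  rw [map_zero]; exact this

lemma VectorField.even_filtered (hH : H.HasInitialForm 𝔛.euler) (U : Opens X.top) (m : ℕ) :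
    ∀ f ∈ filt U m, H.even.toFun U f - (m : ℂ) • f ∈ filt U (m + 1) := by
  intro f hf x hx
  obtain ⟨e, o, he, ho, hle, hlo, he0, he1, -⟩ := exists_stalk_parts hH x
  rw [Nat.cast_smul_eq_nsmul, map_sub, map_nsmul, ← he]
  exact derivation_sub_mem_pow e hle he0 he1 m _ (hf x hx)

/-- The odd part raises the filtration, so it does not affect the eigenvalue of the even part on the
graded pieces. All statements about the operators then apply to `H` and to `H₊` alike. -/
lemma VectorField.act_filtered (hH : H.HasInitialForm 𝔛.euler) (U : Opens X.top) (m : ℕ) :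
    ∀ f ∈ filt U m, H.act U f - (m : ℂ) • f ∈ filt U (m + 1) := by
  intro f hf x hx
  obtain ⟨e, o, he, ho, hle, hlo, he0, he1, ho0, ho1, -⟩ := exists_stalk_parts hH x
  have h1 := twistedDerivation_mem_pow (stalkPar x) (stalkPar_mem x) o hlo ho0 ho1 m _ (hf x hx)
  have h2 := H.even_filtered hH U m f hf x hx
  have h3 : H.act U f - (m : ℂ) • f = H.even.toFun U f - (m : ℂ) • f + H.odd.toFun U f := by
    rw [act, LinearMap.add_apply]; abel
  rw [h3, map_add, ← ho]
  exact add_mem h2 h1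

/-! ### The splitting operators on sections -/

section Operators

variable {q : ℕ} (h𝔛 : 𝔛.IsSupermanifold q) {U : Opens X.top} (T : 𝔛.sec U →ₗ[ℂ] 𝔛.sec U)
  (hT : ∀ m, ∀ f ∈ filt U m, T f - (m : ℂ) • f ∈ filt U (m + 1))

include hT in
lemma aug_polyOp₁ (f : 𝔛.sec U) : 𝔛.aug U (polyOp (splitPoly₁ q) T f) = 𝔛.aug U f := by
  have h := aeval_sub_mem (filt U) (filt_antitone U) T hT (splitPoly₁ q) (mem_filt_zero f)
  rw [splitPoly₁_eval, one_smul, zero_add, mem_filt_one, map_sub, sub_eq_zero] at h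
  exact h

include hT in
lemma polyOp₂_sub_mem {f : 𝔛.sec U} (hf : f ∈ filt U 1) :
    polyOp (splitPoly₂ q) T f - f ∈ filt U 2 := by
  have h := aeval_sub_mem (filt U) (filt_antitone U) T hT (splitPoly₂ q) hf
  rwa [splitPoly₂_eval, one_smul] at h

-- The factors `m, …, q` push `𝒥^m` into `𝒥^(q+1)`, which is zero. The case `m = 1` is the vanishing
-- of `O⁽¹⁾` on `𝒥`, and `m = 2` that of `O⁽²⁾` on `𝒥²`.
include h𝔛 hT in
lemma prodOp_eq_zero (c : ℂ) (m : ℕ) {f : 𝔛.sec U} (hf : f ∈ filt U m) :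
    polyOp (Polynomial.C c * ∏ j ∈ Finset.Icc m q, (Polynomial.C (j : ℂ) - Polynomial.X)) T f =
      0 := by
  have h := filt_eq_bot h𝔛 (aeval_prod_mem (filt U) (filt_antitone U) T hT m (q + 1) hf)
  have h' : Finset.Icc m q = Finset.Ico m (q + 1) := by ext; simp
  rw [polyOp, map_mul, Polynomial.aeval_C, Module.End.mul_apply, h', h, map_zero]

lemma aeval_linear_mul (P : Polynomial ℂ) (c : ℂ) (f : 𝔛.sec U) :
    c • polyOp P T f - T (polyOp P T f) =
      polyOp P T (c • f - T f) := by
  have h : polyOp ((Polynomial.C c - Polynomial.X) * P) T f =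
      polyOp (P * (Polynomial.C c - Polynomial.X)) T f := by rw [mul_comm]
  simpa [polyOp, Module.algebraMap_end_apply] using h

-- `T` commutes with the operator, `T f` lies in `𝒥`, and the operator kills `𝒥`.
include h𝔛 hT in
lemma apply_polyOp₁ (f : 𝔛.sec U) : T (polyOp (splitPoly₁ q) T f) = 0 := by
  have h := aeval_linear_mul T (splitPoly₁ q) 0 f
  have h1 := hT 0 f (mem_filt_zero f)
  rw [Nat.cast_zero, zero_smul, sub_zero] at h1
  rw [zero_smul, zero_sub, zero_smul, zero_sub, map_neg,
    show polyOp (splitPoly₁ q) T (T f) = 0 from prodOp_eq_zero h𝔛 T hT _ 1 h1, neg_inj] at h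
  exact h

-- The same commutation with `1 - T`: for `f` in `𝒥` the section `f - T f` lies in `𝒥²`, which the
-- operator kills.
include h𝔛 hT in
lemma apply_polyOp₂ {f : 𝔛.sec U} (hf : f ∈ filt U 1) :
    T (polyOp (splitPoly₂ q) T f) = polyOp (splitPoly₂ q) T f := by
  have h := aeval_linear_mul T (splitPoly₂ q) 1 f
  have h1 := neg_mem (hT 1 f hf)
  rw [Nat.cast_one, neg_sub] at h1
  rw [show polyOp (splitPoly₂ q) T ((1 : ℂ) • f - T f) = 0 from prodOp_eq_zero h𝔛 T hT _ 2 h1,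
    one_smul, sub_eq_zero] at h
  exact h.symm

end Operators

end Superspace

namespace Superspace

variable {X : ComplexSpace.{u}} {𝔛 : Superspace X}

/-! ### The splitting defined by a vector field -/

/-- Isomorphisms `⋀ (𝒥_x / 𝒥_x²) ≅ 𝒪_{𝔛,x}` defined by the splitting operators of the even part
of `H`. -/
structure IsStalkSplitting (q : ℕ) (H : 𝔛.VectorField) (Ψ : ∀ x, 𝔛.Ext x →+* 𝔛.stalk x) :
    Prop where
  bijective : ∀ x, Function.Bijective (Ψ x)
  fn : ∀ (U : Opens X.top) (f : 𝔛.sec U) x (hx : x ∈ U),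
    Ψ x (algebraMap (X.loc x) (𝔛.Ext x) (X.germ x hx (𝔛.aug U f))) =
      𝔛.germ x hx (polyOp (splitPoly₁ q) (H.even.toFun U) f)
  odd : ∀ (U : Opens X.top) (f : 𝔛.sec U) (hf : ∀ x (hx : x ∈ U), 𝔛.germ x hx f ∈ 𝔛.J x)
    x (hx : x ∈ U), Ψ x (ExteriorAlgebra.ι (X.loc x) (𝔛.cls x ⟨𝔛.germ x hx f, hf x hx⟩)) =
      𝔛.germ x hx (polyOp (splitPoly₂ q) (H.even.toFun U) f)
  aug : ∀ x e, 𝔛.stalkAug x (Ψ x e) = ExteriorAlgebra.algebraMapInv e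
  par : ∀ x e, stalkPar x (Ψ x e) = Ψ x (CliffordAlgebra.involute e)

/-- The operators supply the eigenvectors needed on each stalk: `O⁽¹⁾ f` is a lift of `α(f)` killed
by `H₊`, and `O⁽²⁾ f` is a lift of the class of `f` fixed by `H₊`. They also express `Ψ` through
sections, which is what makes the family over all `x` glue. -/
theorem exists_isStalkSplitting {q : ℕ} (h𝔛 : 𝔛.IsSupermanifold q) {H : 𝔛.VectorField}
    (hH : H.HasInitialForm 𝔛.euler) : ∃ Ψ, IsStalkSplitting q H Ψ := by
  have hT := fun U => H.even_filtered hH U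
  have key : ∀ x, ∃ Ψ : 𝔛.Ext x →+* 𝔛.stalk x, Function.Bijective Ψ ∧
      (∀ (U : Opens X.top) (f : 𝔛.sec U) (hx : x ∈ U),
        Ψ (algebraMap (X.loc x) (𝔛.Ext x) (X.germ x hx (𝔛.aug U f))) =
          𝔛.germ x hx (polyOp (splitPoly₁ q) (H.even.toFun U) f)) ∧
      (∀ (U : Opens X.top) (f : 𝔛.sec U) (hf : ∀ x (hx : x ∈ U), 𝔛.germ x hx f ∈ 𝔛.J x)
        (hx : x ∈ U), Ψ (ExteriorAlgebra.ι (X.loc x) (𝔛.cls x ⟨𝔛.germ x hx f, hf x hx⟩)) =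
          𝔛.germ x hx (polyOp (splitPoly₂ q) (H.even.toFun U) f)) ∧
      (∀ e, 𝔛.stalkAug x (Ψ e) = ExteriorAlgebra.algebraMapInv e) ∧
      ∀ e, stalkPar x (Ψ e) = Ψ (CliffordAlgebra.involute e) := by
    intro x
    obtain ⟨e, o, he, ho, hle, hlo, he0, he1, -, -, hσe⟩ := H.exists_stalk_parts hH x
    obtain ⟨V, hxV, ⟨T⟩⟩ := h𝔛 x
    obtain ⟨γ, hγ, hγ0, hγ1⟩ := T.exists_toExt hxV
    have hfn : ∀ (U : Opens X.top) (f : 𝔛.sec U) (hx : x ∈ U),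
        e (𝔛.germ x hx (polyOp (splitPoly₁ q) (H.even.toFun U) f)) = 0 ∧
        𝔛.stalkAug x (𝔛.germ x hx (polyOp (splitPoly₁ q) (H.even.toFun U) f)) =
          X.germ x hx (𝔛.aug U f) := by
      intro U f hx
      rw [he, apply_polyOp₁ h𝔛 _ (hT U), map_zero, stalkAug_germ, aug_polyOp₁ _ (hT U)]
      exact ⟨rfl, rfl⟩
    have hodd : ∀ (U : Opens X.top) (f : 𝔛.sec U)
        (hf : ∀ x (hx : x ∈ U), 𝔛.germ x hx f ∈ 𝔛.J x) (hx : x ∈ U), ∃ v : 𝔛.J x,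
        (v : 𝔛.stalk x) = 𝔛.germ x hx (polyOp (splitPoly₂ q) (H.even.toFun U) f) ∧ e v = v ∧
          𝔛.cls x v = 𝔛.cls x ⟨𝔛.germ x hx f, hf x hx⟩ := by
      intro U f hf hx
      have hf' : f ∈ filt U 1 := (mem_filt_one f).2 ((forall_germ_mem_J_iff f).1 hf)
      have h1 := aeval_mem (filt U) (filt_antitone U) _ (hT U) (splitPoly₂ q) hf'
      rw [mem_filt_one, ← forall_germ_mem_J_iff] at h1
      refine ⟨⟨_, h1 x hx⟩, rfl, ?_, ?_⟩
      · change e (𝔛.germ x hx (polyOp (splitPoly₂ q) (H.even.toFun U) f)) =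
          𝔛.germ x hx (polyOp (splitPoly₂ q) (H.even.toFun U) f)
        rw [he, apply_polyOp₂ h𝔛 _ (hT U) hf']
      · rw [← sub_eq_zero, ← map_sub, cls_eq_zero]
        have h2 := polyOp₂_sub_mem (q := q) _ (hT U) hf' x hx
        rw [map_sub] at h2
        exact h2
    obtain ⟨Ψ, hb, h0, h1, ha, hp⟩ := exists_stalk_splitting (𝔛.stalkAug x) (J := 𝔛.J x)
      (M := 𝔛.OddCot x) mem_J_iff (T.J_pow_eq_bot hxV) (isUnit_natCast_stalk x)
      (𝔛.cls x).toAddMonoidHom (cls_eq_zero x)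
      (fun a v => by
        change 𝔛.cls x (a • v) = _ • 𝔛.cls x v
        rw [map_smul, stalkAug_smul]) e hle he0 he1
      (fun r => by
        obtain ⟨a, rfl⟩ := 𝔛.stalkAug_surjective x r
        obtain ⟨U, hx, f, rfl⟩ := exists_germ x a
        exact ⟨_, (hfn U f hx).1, by rw [(hfn U f hx).2, stalkAug_germ]⟩)
      (fun m => by
        obtain ⟨⟨a, ha⟩, rfl⟩ := cls_surjective x m
        obtain ⟨U, hx, f, hf, rfl⟩ := exists_germ_of_mem_J ha
        obtain ⟨v, -, hv, hv'⟩ := hodd U f ((forall_germ_mem_J_iff f).2 hf) hx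
        exact ⟨v, hv, hv'⟩)
      (stalkPar x) hσe (stalkPar_sub_mem x) (fun a => commute_of_stalkPar_eq)
      (fun a => sq_eq_zero_of_stalkPar_eq) (T.coord x hxV) (T.coord_mem hxV) (T.J_le hxV)
      (T.stalkPar_coord hxV) γ hγ hγ0 hγ1
    refine ⟨Ψ, hb, fun U f hx => ?_, fun U f hf hx => ?_, ha, hp⟩
    · rw [← (hfn U f hx).2, h0 _ (hfn U f hx).1]
    · obtain ⟨v, hv, hv1, hv2⟩ := hodd U f hf hx
      rw [← hv2, ← hv]
      exact h1 v hv1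
  choose Ψ h1 h2 h3 h4 h5 using key
  exact ⟨Ψ, h1, fun U f x hx => h2 x U f hx, fun U f hf x hx => h3 x U f hf hx, h4, h5⟩

lemma exists_splitGen_eq (x : X.top) (e : 𝔛.Ext x) :
    ∃ (W : Opens X.top) (hx : x ∈ W), ∃ t ∈ 𝔛.splitGen W, t ⟨x, hx⟩ = e := by
  induction e using ExteriorAlgebra.induction with
  | algebraMap r =>
    obtain ⟨a, rfl⟩ := 𝔛.stalkAug_surjective x r
    obtain ⟨U, hx, f, rfl⟩ := exists_germ x a
    exact ⟨U, hx, _, Subring.subset_closure (Or.inl ⟨𝔛.aug U f, rfl⟩), by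
      rw [stalkAug_germ]; rfl⟩
  | ι m =>
    obtain ⟨⟨a, ha⟩, rfl⟩ := cls_surjective x m
    obtain ⟨U, hx, f, hf, rfl⟩ := exists_germ_of_mem_J ha
    exact ⟨U, hx, _, Subring.subset_closure (Or.inr ⟨f, (forall_germ_mem_J_iff f).2 hf, rfl⟩), rfl⟩
  | mul a b ha hb =>
    obtain ⟨W, hW, t, ht, rfl⟩ := ha
    obtain ⟨W', hW', t', ht', rfl⟩ := hb
    exact ⟨W ⊓ W', ⟨hW, hW'⟩, _, Subring.mul_mem _ (splitGen_res inf_le_left ht)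
      (splitGen_res inf_le_right ht'), rfl⟩
  | add a b ha hb =>
    obtain ⟨W, hW, t, ht, rfl⟩ := ha
    obtain ⟨W', hW', t', ht', rfl⟩ := hb
    exact ⟨W ⊓ W', ⟨hW, hW'⟩, _, add_mem (splitGen_res inf_le_left ht)
      (splitGen_res inf_le_right ht'), rfl⟩

/-! ### From stalk isomorphisms to an isomorphism of sheaves -/

namespace IsStalkSplitting

variable {q : ℕ} {H : 𝔛.VectorField} {Ψ : ∀ x, 𝔛.Ext x →+* 𝔛.stalk x}
  (hΨ : IsStalkSplitting q H Ψ)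

-- The sections with the prescribed germs are `O⁽¹⁾ f` and `O⁽²⁾ f` on generators. The
-- trivialization serves only to write a function `g` as `α(f)` over all of `W`.
include hΨ in
lemma exists_section_of_splitGen {V : Opens X.top} (T : 𝔛.LocalTrivialization q V)
    {W : Opens X.top} (hW : W ≤ V) {t : ∀ x : W, 𝔛.Ext x} (ht : t ∈ 𝔛.splitGen W) :
    ∃ F : 𝔛.sec W, ∀ x (hx : x ∈ W), 𝔛.germ x hx F = Ψ x (t ⟨x, hx⟩) := by
  induction ht using Subring.closure_induction with
  | mem s hs =>
    obtain ⟨g, rfl⟩ | ⟨f, hf, rfl⟩ := hs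
    · obtain ⟨f, rfl⟩ := T.exists_aug_eq hW g
      exact ⟨_, fun x hx => (hΨ.fn W f x hx).symm⟩
    · exact ⟨_, fun x hx => (hΨ.odd W f hf x hx).symm⟩
  | zero => exact ⟨0, fun x hx => by rw [Pi.zero_apply, map_zero, map_zero]⟩
  | one => exact ⟨1, fun x hx => by rw [Pi.one_apply, map_one, map_one]⟩
  | add s t _ _ h h' =>
    obtain ⟨a, ha⟩ := h
    obtain ⟨b, hb⟩ := h'
    exact ⟨a + b, fun x hx => by rw [Pi.add_apply, map_add, map_add, ha, hb]⟩
  | neg s _ h =>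
    obtain ⟨a, ha⟩ := h
    exact ⟨-a, fun x hx => by rw [Pi.neg_apply, map_neg, map_neg, ha]⟩
  | mul s t _ _ h h' =>
    obtain ⟨a, ha⟩ := h
    obtain ⟨b, hb⟩ := h'
    exact ⟨a * b, fun x hx => by rw [Pi.mul_apply, map_mul, map_mul, ha, hb]⟩

include hΨ in
lemma exists_section (h𝔛 : 𝔛.IsSupermanifold q) {U : Opens X.top} (s : 𝔛.splitModel.sec U) :
    ∃ F : 𝔛.sec U, ∀ x (hx : x ∈ U), 𝔛.germ x hx F = Ψ x (splitVal s x hx) := by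
  have hs : ∀ x : U, ∃ (W : Opens X.top) (_ : x.1 ∈ W) (hW : W ≤ U) (F : 𝔛.sec W),
      ∀ y (hy : y ∈ W), 𝔛.germ y hy F = Ψ y (splitVal s y (hW hy)) := by
    intro x
    obtain ⟨W, hxW, i, ht⟩ := Subtype.property (p := fun t => t ∈ 𝔛.splitSec U) s x
    obtain ⟨V, hxV, ⟨T⟩⟩ := h𝔛 x.1
    obtain ⟨F, hF⟩ := hΨ.exists_section_of_splitGen T inf_le_right
      (splitGen_res (inf_le_left : W ⊓ V ≤ W) ht)
    exact ⟨W ⊓ V, ⟨hxW, hxV⟩, inf_le_left.trans (leOfHom i), F, hF⟩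
  choose W hxW hW F hF using hs
  obtain ⟨G, hG, -⟩ := TopCat.Sheaf.existsUnique_gluing' 𝔛.sheaf W U (fun x => homOfLE (hW x))
    (fun x hx => Opens.mem_iSup.2 ⟨⟨x, hx⟩, hxW ⟨x, hx⟩⟩) F (by
      intro a b
      refine sec_ext fun x hx => ?_
      have h1 := germ_res (inf_le_left : W a ⊓ W b ≤ W a) x hx (F a)
      have h2 := germ_res (inf_le_right : W a ⊓ W b ≤ W b) x hx (F b)
      exact (h1.trans (hF a x hx.1)).trans (h2.trans (hF b x hx.2)).symm)
  refine ⟨G, fun x hx => ?_⟩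
  rw [← germ_res (hW ⟨x, hx⟩) x (hxW ⟨x, hx⟩) G]
  have h2 : 𝔛.res (hW ⟨x, hx⟩) G = F ⟨x, hx⟩ := hG ⟨x, hx⟩
  rw [h2]
  exact hF ⟨x, hx⟩ x _

include hΨ in
lemma exists_splitSec (h𝔛 : 𝔛.IsSupermanifold q) {U : Opens X.top} (f : 𝔛.sec U) :
    ∃ s : 𝔛.splitModel.sec U, ∀ x (hx : x ∈ U), 𝔛.germ x hx f = Ψ x (splitVal s x hx) := by
  choose s hs using fun x : U => (hΨ.bijective x.1).2 (𝔛.germ x.1 x.2 f)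
  have hmem : s ∈ 𝔛.splitSec U := by
    intro x
    obtain ⟨W, hxW, t, ht, htx⟩ := exists_splitGen_eq x.1 (s x)
    obtain ⟨V, hxV, ⟨T⟩⟩ := h𝔛 x.1
    obtain ⟨F, hF⟩ := hΨ.exists_section_of_splitGen T inf_le_right
      (splitGen_res (inf_le_left : W ⊓ V ≤ W) ht)
    have hxWV : x.1 ∈ W ⊓ V := ⟨hxW, hxV⟩
    -- `t` extends the value of `s` at `x`, and its image `F` has the germ of `f` at `x`. So `F = f`
    -- near `x`, and injectivity of `Ψ` at the nearby points gives `s = t` there.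
    obtain ⟨W', hxW', h1, h2, h12⟩ := exists_res_eq hxWV x.2 (f := F) (g := f)
      ((hF x.1 hxWV).trans ((congrArg (Ψ x.1) htx).trans (hs x)))
    refine ⟨W', hxW', homOfLE h2, ?_⟩
    have h3 := splitGen_res (h1.trans inf_le_left) ht
    convert h3 using 1
    funext y
    apply (hΨ.bijective y.1).1
    refine (hs ⟨y.1, h2 y.2⟩).trans ?_
    rw [← germ_res h2 y.1 y.2, ← h12, germ_res h1, hF]
    rfl
  exact ⟨(⟨s, hmem⟩ : 𝔛.splitSec U), fun x hx => (hs ⟨x, hx⟩).symm⟩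

include hΨ in
lemma exists_ringEquiv (h𝔛 : 𝔛.IsSupermanifold q) (U : Opens X.top) :
    ∃ Θ : 𝔛.splitModel.sec U ≃+* 𝔛.sec U,
      ∀ s x (hx : x ∈ U), 𝔛.germ x hx (Θ s) = Ψ x (splitVal s x hx) := by
  choose Θ hΘ using hΨ.exists_section h𝔛 (U := U)
  let θ : 𝔛.splitModel.sec U →+* 𝔛.sec U :=
    { toFun := Θ
      map_one' := sec_ext fun x hx => by
        rw [hΘ, map_one]; exact map_one (Ψ x)
      map_mul' := fun s t => sec_ext fun x hx => by
        rw [hΘ, map_mul, hΘ, hΘ, splitVal_mul, map_mul]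
      map_zero' := sec_ext fun x hx => by
        rw [hΘ, map_zero]; exact map_zero (Ψ x)
      map_add' := fun s t => sec_ext fun x hx => by
        rw [hΘ, map_add, hΘ, hΘ, splitVal_add, map_add] }
  refine ⟨RingEquiv.ofBijective θ ⟨fun s t hst => ?_, fun f => ?_⟩, hΘ⟩
  · refine splitSec_ext fun x hx => (hΨ.bijective x).1 ?_
    rw [← hΘ, ← hΘ]
    exact congrArg _ hst
  · obtain ⟨s, hs⟩ := hΨ.exists_splitSec h𝔛 f
    exact ⟨s, sec_ext fun x hx => (hΘ s x hx).trans (hs x hx).symm⟩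

end IsStalkSplitting

end Superspace

namespace Superspace

variable {X : ComplexSpace.{u}} {𝔛 : Superspace X}

namespace IsStalkSplitting

variable {q : ℕ} {H : 𝔛.VectorField} {Ψ : ∀ x, 𝔛.Ext x →+* 𝔛.stalk x}
  (hΨ : IsStalkSplitting q H Ψ)

-- `ℂ`-linearity has to be read off from the operators: `O⁽¹⁾` is `ℂ`-linear and fixes `1`, because
-- `Ψ` does, so it fixes the constants.
include hΨ in
lemma map_algebraMap {U : Opens X.top} {Θ : 𝔛.splitModel.sec U ≃+* 𝔛.sec U}
    (hΘ : ∀ s x (hx : x ∈ U), 𝔛.germ x hx (Θ s) = Ψ x (splitVal s x hx)) (c : ℂ) :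
    Θ (algebraMap ℂ _ c) = algebraMap ℂ _ c := by
  have h1 : polyOp (splitPoly₁ q) (H.even.toFun U) 1 = 1 := sec_ext fun x hx => by
    rw [← hΨ.fn, map_one, map_one, map_one, map_one, map_one]
  refine sec_ext fun x hx => ?_
  have h2 : 𝔛.aug U (algebraMap ℂ _ c) = X.const U c :=
    (𝔛.aug_res _ _ le_top _).trans (congrArg _ (𝔛.aug_scalar c))
  have h3 := hΨ.fn U (algebraMap ℂ _ c) x hx
  rw [h2, Algebra.algebraMap_eq_smul_one c, map_smul, h1] at h3
  rw [hΘ, Algebra.algebraMap_eq_smul_one, Algebra.algebraMap_eq_smul_one, splitVal_smul, ← h3]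
  congr 1
  exact mul_one _

/-- The isomorphism with the split model defined by isomorphisms of the stalks. -/
def toIso {Θ : ∀ U, 𝔛.splitModel.sec U ≃+* 𝔛.sec U}
    (hΘ : ∀ U s x (hx : x ∈ U), 𝔛.germ x hx (Θ U s) = Ψ x (splitVal s x hx)) :
    𝔛.Iso 𝔛.splitModel where
  toEquiv U := AlgEquiv.ofRingEquiv (f := (Θ U).symm) fun c => by
    rw [RingEquiv.symm_apply_eq, hΨ.map_algebraMap (hΘ U)]
  res U V h f := by
    change (Θ V).symm (𝔛.res h f) = 𝔛.splitModel.res h ((Θ U).symm f)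
    obtain ⟨s, rfl⟩ := (Θ U).surjective f
    rw [RingEquiv.symm_apply_apply, RingEquiv.symm_apply_eq]
    refine sec_ext fun x hx => ?_
    rw [germ_res, hΘ, hΘ]
    rfl
  parity U i f hf x := by
    obtain ⟨s, rfl⟩ := (Θ U).surjective f
    change splitVal ((Θ U).symm (Θ U s)) x.1 x.2 ∈ _
    rw [RingEquiv.symm_apply_apply]
    refine mem_evenOdd_of_involute ?_ i ?_
    · have h := ((two_ne_zero : (2 : ℂ) ≠ 0).isUnit).map ((X.germ x.1 x.2).comp (X.const U))
      rwa [map_ofNat] at h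
    -- Parity is tested by the involution, which `Ψ` intertwines with the parity involution of the
    -- stalk.
    · apply (hΨ.bijective x.1).1
      rw [← hΨ.par, ← hΘ, stalkPar_germ, par_part hf]
      simp only [map_mul, map_pow, map_neg, map_one, hΘ]
  aug U f := by
    obtain ⟨s, rfl⟩ := (Θ U).surjective f
    change 𝔛.splitAug U ((Θ U).symm (Θ U s)) = _
    rw [RingEquiv.symm_apply_apply]
    refine ComplexSpace.fn_ext _ _ fun x hx => ?_
    rw [← stalkAug_germ, hΘ, hΨ.aug]
    exact germ_splitAug _ x hx

end IsStalkSplitting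

/-- A family of ring endomorphisms of the split model which fixes the functions and the classes of
odd sections is the identity. -/
lemma splitModel_endo_eq_self {U : Opens X.top} (s : 𝔛.splitModel.sec U)
    (α : ∀ U, 𝔛.splitModel.sec U →+* 𝔛.splitModel.sec U)
    (hres : ∀ U W (h : W ≤ U) s, α W (𝔛.splitModel.res h s) = 𝔛.splitModel.res h (α U s))
    (hα : ∀ x : X.top, ∃ V : Opens X.top, x ∈ V ∧ ∀ W ≤ V,
      (∀ s g, (∀ y hy, splitVal s y hy = ofFn g ⟨y, hy⟩) → α W s = s) ∧
      ∀ s f hf, (∀ y hy, splitVal s y hy = ofOdd f hf ⟨y, hy⟩) → α W s = s) : α U s = s := by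
  refine splitSec_ext fun x hx => ?_
  obtain ⟨V, hxV, hV⟩ := hα x
  obtain ⟨W, hxW, i, ht⟩ := Subtype.property (p := fun t => t ∈ 𝔛.splitSec U) s ⟨x, hx⟩
  have hWV : W ⊓ V ≤ U := inf_le_left.trans (leOfHom i)
  have ht' := splitGen_res (inf_le_left : W ⊓ V ≤ W) ht
  let α' : 𝔛.splitSec (W ⊓ V) →+* 𝔛.splitSec (W ⊓ V) := α (W ⊓ V)
  -- The sections fixed by the endomorphism form a subring, so it is enough to find the generators
  -- in it.
  have hle : 𝔛.splitGen (W ⊓ V) ≤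
      (RingHom.eqLocus α' (RingHom.id _)).map (𝔛.splitSec (W ⊓ V)).subtype := by
    refine Subring.closure_le.2 ?_
    rintro t (⟨g, rfl⟩ | ⟨f, hf, rfl⟩)
    · let r : 𝔛.splitSec (W ⊓ V) := ⟨ofFn g, ofFn_mem g⟩
      exact ⟨r, (hV _ inf_le_right).1 r g fun _ _ => rfl, rfl⟩
    · let r : 𝔛.splitSec (W ⊓ V) := ⟨ofOdd f hf, TopCat.PrelocalPredicate.sheafifyOf
        (Subring.subset_closure (Or.inr ⟨f, hf, rfl⟩))⟩
      exact ⟨r, (hV _ inf_le_right).2 r f hf fun _ _ => rfl, rfl⟩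
  obtain ⟨r, hr, hrt⟩ := hle ht'
  have hr' : r = 𝔛.splitModel.res hWV s := Subtype.ext hrt
  have h1 : α (W ⊓ V) (𝔛.splitModel.res hWV s) = 𝔛.splitModel.res hWV s := hr' ▸ hr
  rw [hres] at h1
  have hxWV : x ∈ W ⊓ V := ⟨hxW, hxV⟩
  exact congrArg (fun t => splitVal t x hxWV) h1

end Superspace

/-! ### Existence and uniqueness of the splitting -/

open Superspace in
theorem exists_unique_splitting (X : ComplexSpace.{u}) (𝔛 : Superspace X) (q : ℕ)
    (h𝔛 : 𝔛.IsSupermanifold q) (H : 𝔛.VectorField) (hH : H.HasInitialForm 𝔛.euler) :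
    ∃! Φ : 𝔛.Iso 𝔛.splitModel,
      (∀ U (f : 𝔛.sec U) x (hx : x ∈ U),
        Superspace.splitVal (Φ.toEquiv U
            (Superspace.polyOp (Superspace.splitPoly₁ q) (H.even.toFun U) f)) x hx =
          algebraMap (X.loc x) (𝔛.Ext x) (X.germ x hx (𝔛.aug U f))) ∧
      (∀ U (f : 𝔛.sec U) (hf : ∀ x (hx : x ∈ U), 𝔛.germ x hx f ∈ 𝔛.J x) x (hx : x ∈ U),
        Superspace.splitVal (Φ.toEquiv U
            (Superspace.polyOp (Superspace.splitPoly₂ q) (H.even.toFun U) f)) x hx =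
          ExteriorAlgebra.ι (X.loc x) (𝔛.cls x ⟨𝔛.germ x hx f, hf x hx⟩)) := by
  obtain ⟨Ψ, hΨ⟩ := exists_isStalkSplitting h𝔛 hH
  choose Θ hΘ using hΨ.exists_ringEquiv h𝔛
  have hval : ∀ U (f : 𝔛.sec U) x (hx : x ∈ U),
      Ψ x (splitVal ((hΨ.toIso hΘ).toEquiv U f) x hx) = 𝔛.germ x hx f := by
    intro U f x hx
    obtain ⟨s, rfl⟩ := (Θ U).surjective f
    change Ψ x (splitVal ((Θ U).symm (Θ U s)) x hx) = _
    rw [RingEquiv.symm_apply_apply, hΘ]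
  refine ⟨hΨ.toIso hΘ, ⟨fun U f x hx => (hΨ.bijective x).1 ?_, fun U f hf x hx =>
    (hΨ.bijective x).1 ?_⟩, fun Φ hΦ => ?_⟩
  · rw [hval, hΨ.fn]
  · rw [hval, hΨ.odd]
  have hΘres : ∀ U W (h : W ≤ U) s, Θ W (𝔛.splitModel.res h s) = 𝔛.res h (Θ U s) := by
    intro U W h s
    refine sec_ext fun x hx => ?_
    rw [germ_res, hΘ, hΘ]
    rfl
  -- Uniqueness: `Θ` sends `α(f)` to `O⁽¹⁾ f` and the class of `f` to `O⁽²⁾ f`, and `Φ` sends these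
  -- back. Hence `Φ ∘ Θ` fixes the local generators of the split model.
  have key : ∀ U s, Φ.toEquiv U (Θ U s) = s := by
    intro U s
    refine splitModel_endo_eq_self s
      (fun U => (Φ.toEquiv U : 𝔛.sec U →+* 𝔛.splitModel.sec U).comp (Θ U : _ →+* 𝔛.sec U))
      (fun U W h s => ?_) fun x => ?_
    · change Φ.toEquiv W (Θ W (𝔛.splitModel.res h s)) = 𝔛.splitModel.res h (Φ.toEquiv U (Θ U s))
      rw [hΘres, Φ.res]
    · obtain ⟨V, hxV, ⟨T⟩⟩ := h𝔛 x
      refine ⟨V, hxV, fun W hW => ⟨fun s g hs => ?_, fun s f hf hs => ?_⟩⟩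
      · obtain ⟨f, rfl⟩ := T.exists_aug_eq hW g
        have h1 : Θ W s = polyOp (splitPoly₁ q) (H.even.toFun W) f := sec_ext fun y hy => by
          rw [hΘ, ← hΨ.fn, hs]; rfl
        refine splitSec_ext fun y hy => ?_
        change splitVal (Φ.toEquiv W (Θ W s)) y hy = _
        rw [h1, hΦ.1, hs]; rfl
      · have h1 : Θ W s = polyOp (splitPoly₂ q) (H.even.toFun W) f := sec_ext fun y hy => by
          rw [hΘ, ← hΨ.odd W f hf, hs]; rfl
        refine splitSec_ext fun y hy => ?_
        change splitVal (Φ.toEquiv W (Θ W s)) y hy = _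
        rw [h1, hΦ.2 W f hf, hs]; rfl
  refine Superspace.Iso.ext (funext fun U => AlgEquiv.ext fun f => ?_)
  obtain ⟨s, rfl⟩ := (Θ U).surjective f
  rw [key]
  exact ((Θ U).symm_apply_apply s).symm

theorem mainTheorem3 (X : ComplexSpace.{u}) (𝔛 : Superspace X) (q : ℕ)
    (h𝔛 : 𝔛.IsSupermanifold q) (H : 𝔛.VectorField) (hH : H.HasInitialForm 𝔛.euler) :
    -- the operator `O₁ = (1/q!) ∏ (j - H)` splits `0 → 𝒥 → 𝒪 → 𝒪_X → 0`
    (∀ U (f : 𝔛.sec U),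
      (Superspace.polyOp (Superspace.splitPoly₁ q) (H.act U) f = 0 ↔ 𝔛.aug U f = 0) ∧
      𝔛.aug U (Superspace.polyOp (Superspace.splitPoly₁ q) (H.act U) f) = 𝔛.aug U f) ∧
    -- the operator `O₂ = (1/(q-1)!) ∏ (j - H)` splits `0 → 𝒥² → 𝒥 → T*_{X,-} → 0`
    (∀ U, ∀ f ∈ 𝔛.powJ 1 U,
      Superspace.polyOp (Superspace.splitPoly₂ q) (H.act U) f ∈ 𝔛.powJ 1 U ∧
      (Superspace.polyOp (Superspace.splitPoly₂ q) (H.act U) f = 0 ↔ f ∈ 𝔛.powJ 2 U) ∧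
      Superspace.polyOp (Superspace.splitPoly₂ q) (H.act U) f - f ∈ 𝔛.powJ 2 U) ∧
    -- the operators of the even part of `H` define a splitting
    (∃! Φ : 𝔛.Iso 𝔛.splitModel,
      (∀ U (f : 𝔛.sec U) x (hx : x ∈ U),
        Superspace.splitVal (Φ.toEquiv U
            (Superspace.polyOp (Superspace.splitPoly₁ q) (H.even.toFun U) f)) x hx =
          algebraMap (X.loc x) (𝔛.Ext x) (X.germ x hx (𝔛.aug U f))) ∧
      (∀ U (f : 𝔛.sec U) (hf : ∀ x (hx : x ∈ U), 𝔛.germ x hx f ∈ 𝔛.J x) x (hx : x ∈ U),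
        Superspace.splitVal (Φ.toEquiv U
            (Superspace.polyOp (Superspace.splitPoly₂ q) (H.even.toFun U) f)) x hx =
          ExteriorAlgebra.ι (X.loc x) (𝔛.cls x ⟨𝔛.germ x hx f, hf x hx⟩))) := by
  have hT := fun U => H.act_filtered hH U
  refine ⟨fun U f => ?_, fun U f hf => ?_, exists_unique_splitting X 𝔛 q h𝔛 H hH⟩
  · have h := Superspace.aug_polyOp₁ (q := q) (H.act U) (hT U) f
    -- The congruence `O⁽¹⁾ f ≡ f` shows that the kernel lies in `𝒥`; the converse is the nilpotence
    -- argument.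
    refine ⟨⟨fun h0 => ?_, fun h0 => ?_⟩, h⟩
    · rw [← h, h0, map_zero]
    · exact Superspace.prodOp_eq_zero h𝔛 _ (hT U) _ 1 ((Superspace.mem_filt_one f).2 h0)
  · have h := Superspace.polyOp₂_sub_mem (q := q) (H.act U) (hT U) hf
    refine ⟨aeval_mem (Superspace.filt U) (Superspace.filt_antitone U) _ (hT U) _ hf,
      ⟨fun h0 => ?_, fun h0 => ?_⟩, h⟩
    · rw [h0, zero_sub, neg_mem_iff] at h
      exact h
    · exact Superspace.prodOp_eq_zero h𝔛 _ (hT U) _ 2 h0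

end
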